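/- Let $K$ be a field, let $Q$ be a quiver (possibly infinite) with vertex set $Q_0$, and let $KQ$ be its path coalgebra, that is, the vector space with basis all paths, with $\Delta(p)=\sum_{\eta\tau=p}\eta\otimes\tau$ (where $\tau$ is the initial and $\eta$ the final part of $p$) and with counit equal to $1$ on the trivial paths and $0$ on all other paths. Let $C\subseteq KQ$ be an admissible subcoalgebra, i.e. one containing all vertices (trivial paths) and all arrows, and let $X\subseteq Q_0$. Let $e=e_X\in C^*$ be the restriction to $C$ of the linear functional on $KQ$ that is $1$ on the trivial paths at vertices of $X$ and $0$ on all other paths; it is an idempotent for the convolution product. Write $ec=\sum c_{(1)}e(c_{(2)})$ and $ce=\sum e(c_{(1)})c_{(2)}$ for $c\in C$; thus $eCe$ is a coalgebra with $\Delta(x)=\sum ex_{(1)}e\otimes ex_{(2)}e$ and the counit of $C$ restricted to $eCe$, and $eC$ is a right $eCe$-comodule with $\rho(p)=\sum ep_{(1)}\otimes ep_{(2)}e$. Let $\mathcal M^C$ be the category of right $C$-comodules and let $\mathcal T_X\subseteq\mathcal M^C$ be the localizing subcategory of all comodules $M$ with $eM=0$, where $em=\sum m_{(0)}e(m_{(1)})$.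 For $x\in X$ let $\mathcal Tail^Q_X(x)$ be the set of all nontrivial paths in $Q$ that start at $x$ and all of whose arrows end at vertices outside $X$. Then the following conditions are equivalent: (a) $\mathcal T_X$ is colocalizing, i.e. the quotient functor $\mathcal M^C\to\mathcal M^C/\mathcal T_X$ has a left adjoint. (b) $e_XC$ is a quasifinite right $e_XCe_X$-comodule, i.e. $\operatorname{Hom}_{e_XCe_X}(S,e_XC)$ is finite-dimensional over $K$ for every simple right $e_XCe_X$-comodule $S$. (c) $\dim_K\bigl(K\,\mathcal Tail^Q_X(x)\cap C\bigr)$ is finite for every $x\in X$. -/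

import Mathlib

open CategoryTheory CategoryTheory.Limits
open scoped TensorProduct

universe t u v w

noncomputable section

/-! ### Right comodules over a coalgebra -/

/-- A right comodule over the coalgebra `C` over the field `K`. -/
structure RightComodule (K : Type u) [Field K] (C : Type t) [AddCommGroup C] [Module K C]
    [Coalgebra K C] where
  carrier : Type t
  [addCommGroup : AddCommGroup carrier]
  [module : Module K carrier]
  /-- the structure map `M → M ⊗ C` -/
  coact : carrier →ₗ[K] carrier ⊗[K] C
  coassoc : (TensorProduct.assoc K carrier C C).toLinearMap ∘ₗ coact.rTensor C ∘ₗ coact =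
    (Coalgebra.comul (R := K) (A := C)).lTensor carrier ∘ₗ coact
  counit : (Coalgebra.counit (R := K) (A := C)).lTensor carrier ∘ₗ coact =
    (TensorProduct.mk K carrier K).flip 1

namespace RightComodule

variable {K : Type u} [Field K] {C : Type t} [AddCommGroup C] [Module K C] [Coalgebra K C]

instance : CoeSort (RightComodule K C) (Type t) := ⟨RightComodule.carrier⟩

instance (M : RightComodule K C) : AddCommGroup M := M.addCommGroup

instance (M : RightComodule K C) : Module K M := M.module

/-- Homomorphisms of right comodules. -/
@[ext]
structure Hom (M N : RightComodule K C) where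
  lin : M →ₗ[K] N
  comm : N.coact ∘ₗ lin = lin.rTensor C ∘ₗ M.coact

/-- The category of all right `C`-comodules. -/
instance : Category (RightComodule K C) where
  Hom M N := Hom M N
  id M := ⟨LinearMap.id, by simp⟩
  comp f g := ⟨g.lin ∘ₗ f.lin, by
    rw [← LinearMap.comp_assoc, g.comm, LinearMap.comp_assoc, f.comm, ← LinearMap.comp_assoc,
      LinearMap.rTensor_comp]⟩

@[ext]
theorem hom_ext {M N : RightComodule K C} {f g : M ⟶ N} (h : f.lin = g.lin) : f = g :=
  Hom.ext h

@[simp] theorem id_lin (M : RightComodule K C) : Hom.lin (𝟙 M) = LinearMap.id := rfl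

@[simp] theorem comp_lin {M N P : RightComodule K C} (f : M ⟶ N) (g : N ⟶ P) :
    (f ≫ g).lin = g.lin ∘ₗ f.lin := rfl

theorem lin_coact {M N : RightComodule K C} (f : M ⟶ N) (m : M) :
    N.coact (f.lin m) = f.lin.rTensor C (M.coact m) := LinearMap.congr_fun f.comm m

section Linear

variable (M N : RightComodule K C)

instance : Zero (M ⟶ N) := ⟨⟨0, by simp⟩⟩
instance : Add (M ⟶ N) := ⟨fun f g => ⟨f.lin + g.lin, by
  rw [LinearMap.comp_add, f.comm, g.comm, LinearMap.rTensor_add, LinearMap.add_comp]⟩⟩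
instance : Neg (M ⟶ N) := ⟨fun f => ⟨-f.lin, by
  rw [LinearMap.comp_neg, f.comm, LinearMap.rTensor_neg, LinearMap.neg_comp]⟩⟩
instance : Sub (M ⟶ N) := ⟨fun f g => ⟨f.lin - g.lin, by
  rw [LinearMap.comp_sub, f.comm, g.comm, LinearMap.rTensor_sub, LinearMap.sub_comp]⟩⟩
instance : SMul K (M ⟶ N) := ⟨fun a f => ⟨a • f.lin, by
  rw [LinearMap.comp_smul, f.comm, LinearMap.rTensor_smul, LinearMap.smul_comp]⟩⟩
instance : SMul ℕ (M ⟶ N) := ⟨fun a f => ⟨a • f.lin, by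
  rw [← Nat.cast_smul_eq_nsmul K, LinearMap.comp_smul, f.comm, LinearMap.rTensor_smul,
    LinearMap.smul_comp]⟩⟩
instance : SMul ℤ (M ⟶ N) := ⟨fun a f => ⟨a • f.lin, by
  rw [← Int.cast_smul_eq_zsmul K, LinearMap.comp_smul, f.comm, LinearMap.rTensor_smul,
    LinearMap.smul_comp]⟩⟩

variable {M N}

@[simp] theorem zero_lin : Hom.lin (0 : M ⟶ N) = 0 := rfl
@[simp] theorem add_lin (f g : M ⟶ N) : (f + g).lin = f.lin + g.lin := rfl
@[simp] theorem neg_lin (f : M ⟶ N) : (-f).lin = -f.lin := rfl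
@[simp] theorem sub_lin (f g : M ⟶ N) : (f - g).lin = f.lin - g.lin := rfl
@[simp] theorem smul_lin (a : K) (f : M ⟶ N) : (a • f).lin = a • f.lin := rfl

theorem lin_injective : Function.Injective (fun f : M ⟶ N => f.lin) := fun _ _ h => hom_ext h

instance : AddCommGroup (M ⟶ N) :=
  Function.Injective.addCommGroup (fun f : M ⟶ N => f.lin) lin_injective rfl (fun _ _ => rfl)
    (fun _ => rfl) (fun _ _ => rfl) (fun _ _ => rfl) (fun _ _ => rfl)

/-- Taking the underlying linear map, as an additive homomorphism. -/
def linHom : (M ⟶ N) →+ (M →ₗ[K] N) where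
  toFun f := f.lin
  map_zero' := rfl
  map_add' _ _ := rfl

instance : Module K (M ⟶ N) :=
  Function.Injective.module K linHom lin_injective (fun _ _ => rfl)

end Linear

instance : Preadditive (RightComodule K C) where
  add_comp _ _ _ _ _ _ := by ext; simp
  comp_add _ _ _ _ _ _ := by ext; simp

instance : CategoryTheory.Linear K (RightComodule K C) where
  smul_comp _ _ _ _ _ _ := by ext; simp
  comp_smul _ _ _ _ _ _ := by ext; simp

/-! ### Subcomodules, quotient comodules and sums: comodules form an abelian category -/

theorem coassoc_of_injective {S : Type t} [AddCommGroup S] [Module K S] (M : RightComodule K C)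
    (ρ : S →ₗ[K] S ⊗[K] C) (j : S →ₗ[K] M) (hj : Function.Injective j)
    (h : M.coact ∘ₗ j = j.rTensor C ∘ₗ ρ) :
    (TensorProduct.assoc K S C C).toLinearMap ∘ₗ ρ.rTensor C ∘ₗ ρ =
      (Coalgebra.comul (R := K) (A := C)).lTensor S ∘ₗ ρ := by
  have hinj : Function.Injective (j.rTensor (C ⊗[K] C)) :=
    Module.Flat.rTensor_preserves_injective_linearMap _ hj
  refine LinearMap.cancel_left hinj |>.1 ?_
  have e1 : j.rTensor (C ⊗[K] C) ∘ₗ (TensorProduct.assoc K S C C).toLinearMap =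
      (TensorProduct.assoc K M C C).toLinearMap ∘ₗ (j.rTensor C).rTensor C := by
    ext; simp
  have e2 : j.rTensor (C ⊗[K] C) ∘ₗ (Coalgebra.comul (R := K) (A := C)).lTensor S =
      (Coalgebra.comul (R := K) (A := C)).lTensor M ∘ₗ j.rTensor C := by
    rw [LinearMap.rTensor_comp_lTensor, LinearMap.lTensor_comp_rTensor]
  calc _ = (TensorProduct.assoc K M C C).toLinearMap ∘ₗ
        ((j.rTensor C ∘ₗ ρ).rTensor C) ∘ₗ ρ := by
        rw [← LinearMap.comp_assoc, e1, LinearMap.rTensor_comp]; rfl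
    _ = ((TensorProduct.assoc K M C C).toLinearMap ∘ₗ M.coact.rTensor C ∘ₗ M.coact) ∘ₗ j := by
        rw [← h, LinearMap.rTensor_comp, LinearMap.comp_assoc, ← h]; rfl
    _ = _ := by
        rw [M.coassoc, LinearMap.comp_assoc, h, ← LinearMap.comp_assoc, ← e2]; rfl

theorem counit_of_injective {S : Type t} [AddCommGroup S] [Module K S] (M : RightComodule K C)
    (ρ : S →ₗ[K] S ⊗[K] C) (j : S →ₗ[K] M) (hj : Function.Injective j)
    (h : M.coact ∘ₗ j = j.rTensor C ∘ₗ ρ) :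
    (Coalgebra.counit (R := K) (A := C)).lTensor S ∘ₗ ρ = (TensorProduct.mk K S K).flip 1 := by
  have hinj : Function.Injective (j.rTensor K) :=
    Module.Flat.rTensor_preserves_injective_linearMap _ hj
  refine LinearMap.cancel_left hinj |>.1 ?_
  have e2 : j.rTensor K ∘ₗ (Coalgebra.counit (R := K) (A := C)).lTensor S =
      (Coalgebra.counit (R := K) (A := C)).lTensor M ∘ₗ j.rTensor C := by
    rw [LinearMap.rTensor_comp_lTensor, LinearMap.lTensor_comp_rTensor]
  rw [← LinearMap.comp_assoc, e2, LinearMap.comp_assoc, ← h, ← LinearMap.comp_assoc, M.counit]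
  ext; simp

theorem coassoc_comp {Q : Type t} [AddCommGroup Q] [Module K Q] (M : RightComodule K C)
    (ρ : Q →ₗ[K] Q ⊗[K] C) (q : M →ₗ[K] Q) (h : ρ ∘ₗ q = q.rTensor C ∘ₗ M.coact) :
    ((TensorProduct.assoc K Q C C).toLinearMap ∘ₗ ρ.rTensor C ∘ₗ ρ) ∘ₗ q =
      ((Coalgebra.comul (R := K) (A := C)).lTensor Q ∘ₗ ρ) ∘ₗ q := by
  have e1 : q.rTensor (C ⊗[K] C) ∘ₗ (TensorProduct.assoc K M C C).toLinearMap =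
      (TensorProduct.assoc K Q C C).toLinearMap ∘ₗ (q.rTensor C).rTensor C := by
    ext; simp
  have e2 : q.rTensor (C ⊗[K] C) ∘ₗ (Coalgebra.comul (R := K) (A := C)).lTensor M =
      (Coalgebra.comul (R := K) (A := C)).lTensor Q ∘ₗ q.rTensor C := by
    rw [LinearMap.rTensor_comp_lTensor, LinearMap.lTensor_comp_rTensor]
  calc _ = (TensorProduct.assoc K Q C C).toLinearMap ∘ₗ
        ((ρ ∘ₗ q).rTensor C) ∘ₗ M.coact := by
        rw [LinearMap.rTensor_comp, LinearMap.comp_assoc, LinearMap.comp_assoc, h]; rfl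
    _ = q.rTensor (C ⊗[K] C) ∘ₗ
        ((TensorProduct.assoc K M C C).toLinearMap ∘ₗ M.coact.rTensor C ∘ₗ M.coact) := by
        rw [h, LinearMap.rTensor_comp, ← LinearMap.comp_assoc _ _ (q.rTensor (C ⊗[K] C)), e1]; rfl
    _ = _ := by
        rw [M.coassoc, ← LinearMap.comp_assoc, e2, LinearMap.comp_assoc, ← h]; rfl

theorem counit_comp {Q : Type t} [AddCommGroup Q] [Module K Q] (M : RightComodule K C)
    (ρ : Q →ₗ[K] Q ⊗[K] C) (q : M →ₗ[K] Q) (h : ρ ∘ₗ q = q.rTensor C ∘ₗ M.coact) :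
    ((Coalgebra.counit (R := K) (A := C)).lTensor Q ∘ₗ ρ) ∘ₗ q =
      (TensorProduct.mk K Q K).flip 1 ∘ₗ q := by
  have e2 : q.rTensor K ∘ₗ (Coalgebra.counit (R := K) (A := C)).lTensor M =
      (Coalgebra.counit (R := K) (A := C)).lTensor Q ∘ₗ q.rTensor C := by
    rw [LinearMap.rTensor_comp_lTensor, LinearMap.lTensor_comp_rTensor]
  rw [LinearMap.comp_assoc, h, ← LinearMap.comp_assoc, ← e2, LinearMap.comp_assoc, M.counit]
  ext; simp

/-- A subspace `S` of `M` is a subcomodule if the structure map takes `S` into `S ⊗ C`. -/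
def IsSubcomodule (M : RightComodule K C) (S : Submodule K M) : Prop :=
  ∀ m ∈ S, M.coact m ∈ LinearMap.range (S.subtype.rTensor C)

theorem subtype_rTensor_injective {M : RightComodule K C} (S : Submodule K M) :
    Function.Injective (S.subtype.rTensor C) :=
  Module.Flat.rTensor_preserves_injective_linearMap _ S.injective_subtype

/-- The structure map of a subcomodule. -/
def subCoact (M : RightComodule K C) (S : Submodule K M) (hS : M.IsSubcomodule S) :
    S →ₗ[K] S ⊗[K] C :=
  (LinearEquiv.ofInjective (S.subtype.rTensor C) (subtype_rTensor_injective S)).symm.toLinearMap ∘ₗ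
    (M.coact ∘ₗ S.subtype).codRestrict _ (fun m => hS m m.2)

theorem subCoact_spec (M : RightComodule K C) (S : Submodule K M) (hS : M.IsSubcomodule S) :
    M.coact ∘ₗ S.subtype = S.subtype.rTensor C ∘ₗ M.subCoact S hS := by
  ext m
  have := LinearEquiv.apply_symm_apply
    (LinearEquiv.ofInjective (S.subtype.rTensor C) (subtype_rTensor_injective S))
    ((M.coact ∘ₗ S.subtype).codRestrict _ (fun m => hS m m.2) m)
  exact (congrArg Subtype.val this).symm

/-- A subcomodule, as a comodule. -/
def sub (M : RightComodule K C) (S : Submodule K M) (hS : M.IsSubcomodule S) :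
    RightComodule K C where
  carrier := S
  coact := M.subCoact S hS
  coassoc := coassoc_of_injective M _ S.subtype S.injective_subtype (M.subCoact_spec S hS)
  counit := counit_of_injective M _ S.subtype S.injective_subtype (M.subCoact_spec S hS)

/-- The inclusion of a subcomodule. -/
def subι (M : RightComodule K C) (S : Submodule K M) (hS : M.IsSubcomodule S) :
    M.sub S hS ⟶ M :=
  ⟨S.subtype, M.subCoact_spec S hS⟩

theorem mkQ_rTensor_coact (M : RightComodule K C) (S : Submodule K M) (hS : M.IsSubcomodule S) :
    S ≤ LinearMap.ker (S.mkQ.rTensor C ∘ₗ M.coact) := by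
  intro m hm
  obtain ⟨z, hz⟩ := hS m hm
  have h0 : S.mkQ ∘ₗ S.subtype = 0 := by ext x; simp
  rw [LinearMap.mem_ker, LinearMap.comp_apply, ← hz, ← LinearMap.comp_apply,
    ← LinearMap.rTensor_comp, h0]
  simp

/-- A quotient comodule. -/
def quot (M : RightComodule K C) (S : Submodule K M) (hS : M.IsSubcomodule S) :
    RightComodule K C where
  carrier := M ⧸ S
  coact := S.liftQ (S.mkQ.rTensor C ∘ₗ M.coact) (M.mkQ_rTensor_coact S hS)
  coassoc := (LinearMap.cancel_right S.mkQ_surjective).1 (coassoc_comp M _ S.mkQ (S.liftQ_mkQ _ _))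
  counit := (LinearMap.cancel_right S.mkQ_surjective).1 (counit_comp M _ S.mkQ (S.liftQ_mkQ _ _))

/-- The projection onto a quotient comodule. -/
def quotπ (M : RightComodule K C) (S : Submodule K M) (hS : M.IsSubcomodule S) :
    M ⟶ M.quot S hS :=
  ⟨S.mkQ, S.liftQ_mkQ _ _⟩

theorem isSubcomodule_ker {M N : RightComodule K C} (f : M ⟶ N) :
    M.IsSubcomodule (LinearMap.ker f.lin) := by
  intro m hm
  have hex := Module.Flat.rTensor_exact C (LinearMap.exact_subtype_ker_map f.lin)
  refine (hex (M.coact m)).1 ?_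
  rw [← lin_coact, LinearMap.mem_ker.1 hm, map_zero]

theorem isSubcomodule_range {M N : RightComodule K C} (f : M ⟶ N) :
    N.IsSubcomodule (LinearMap.range f.lin) := by
  rintro _ ⟨m, rfl⟩
  refine ⟨f.lin.rangeRestrict.rTensor C (M.coact m), ?_⟩
  rw [← LinearMap.comp_apply, ← LinearMap.rTensor_comp, LinearMap.subtype_comp_codRestrict,
    lin_coact]

/-- A homomorphism whose values lie in the image of an injective one factors through it. -/
def liftInj {W M N : RightComodule K C} (f : M ⟶ N) (hf : Function.Injective f.lin) (k : W ⟶ N)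
    (h : ∀ x, k.lin x ∈ LinearMap.range f.lin) : W ⟶ M :=
  have hl : f.lin ∘ₗ ((LinearEquiv.ofInjective f.lin hf).symm.toLinearMap ∘ₗ
      k.lin.codRestrict _ h) = k.lin := by
    ext x
    exact congrArg Subtype.val (LinearEquiv.apply_symm_apply (LinearEquiv.ofInjective f.lin hf)
      (k.lin.codRestrict _ h x))
  ⟨(LinearEquiv.ofInjective f.lin hf).symm.toLinearMap ∘ₗ k.lin.codRestrict _ h, by
    have hinj : Function.Injective (f.lin.rTensor C) :=
      Module.Flat.rTensor_preserves_injective_linearMap _ hf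
    refine LinearMap.cancel_left hinj |>.1 ?_
    rw [← LinearMap.comp_assoc, ← f.comm, LinearMap.comp_assoc, hl, ← LinearMap.comp_assoc,
      ← LinearMap.rTensor_comp, hl, k.comm]⟩

theorem liftInj_fac {W M N : RightComodule K C} (f : M ⟶ N) (hf : Function.Injective f.lin)
    (k : W ⟶ N) (h : ∀ x, k.lin x ∈ LinearMap.range f.lin) : liftInj f hf k h ≫ f = k := by
  ext x
  exact congrArg Subtype.val (LinearEquiv.apply_symm_apply (LinearEquiv.ofInjective f.lin hf)
      (k.lin.codRestrict _ h x))

/-- A homomorphism that vanishes on the kernel of a surjective one factors through it. -/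
def descSurj {W M N : RightComodule K C} (f : M ⟶ N) (hf : Function.Surjective f.lin) (k : M ⟶ W)
    (h : LinearMap.ker f.lin ≤ LinearMap.ker k.lin) : N ⟶ W :=
  have hl : ((LinearMap.ker f.lin).liftQ k.lin h ∘ₗ
      (f.lin.quotKerEquivOfSurjective hf).symm.toLinearMap) ∘ₗ f.lin = k.lin := by
    ext x
    have : (f.lin.quotKerEquivOfSurjective hf).symm (f.lin x) =
        (LinearMap.ker f.lin).mkQ x := by
      rw [LinearEquiv.symm_apply_eq]; rfl
    simp [this]
  ⟨(LinearMap.ker f.lin).liftQ k.lin h ∘ₗ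
      (f.lin.quotKerEquivOfSurjective hf).symm.toLinearMap, by
    refine LinearMap.cancel_right hf |>.1 ?_
    rw [LinearMap.comp_assoc, hl, LinearMap.comp_assoc, f.comm, ← LinearMap.comp_assoc,
      ← LinearMap.rTensor_comp, hl, k.comm]⟩

theorem descSurj_fac {W M N : RightComodule K C} (f : M ⟶ N) (hf : Function.Surjective f.lin)
    (k : M ⟶ W) (h : LinearMap.ker f.lin ≤ LinearMap.ker k.lin) : f ≫ descSurj f hf k h = k := by
  ext x
  have : (f.lin.quotKerEquivOfSurjective hf).symm (f.lin x) =
      (LinearMap.ker f.lin).mkQ x := by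
    rw [LinearEquiv.symm_apply_eq]; rfl
  simp [descSurj, this]

theorem mono_of_injective {M N : RightComodule K C} (f : M ⟶ N) (hf : Function.Injective f.lin) :
    Mono f :=
  ⟨fun _ _ h => hom_ext ((LinearMap.cancel_left hf).1 (congrArg Hom.lin h))⟩

theorem epi_of_surjective {M N : RightComodule K C} (f : M ⟶ N) (hf : Function.Surjective f.lin) :
    Epi f :=
  ⟨fun _ _ h => hom_ext ((LinearMap.cancel_right hf).1 (congrArg Hom.lin h))⟩

theorem injective_of_mono {M N : RightComodule K C} (f : M ⟶ N) [Mono f] :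
    Function.Injective f.lin := by
  have h : M.subι _ (isSubcomodule_ker f) = 0 := by
    refine zero_of_comp_mono f ?_
    ext x
    exact x.2
  rw [← LinearMap.ker_eq_bot, eq_bot_iff]
  intro x hx
  exact LinearMap.congr_fun (congrArg Hom.lin h) ⟨x, hx⟩

theorem surjective_of_epi {M N : RightComodule K C} (f : M ⟶ N) [Epi f] :
    Function.Surjective f.lin := by
  have h : N.quotπ _ (isSubcomodule_range f) = 0 := by
    refine zero_of_epi_comp f ?_
    ext x
    exact (Submodule.Quotient.mk_eq_zero _).2 ⟨x, rfl⟩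
  rw [← LinearMap.range_eq_top, eq_top_iff]
  intro x _
  exact (Submodule.Quotient.mk_eq_zero _).1 (LinearMap.congr_fun (congrArg Hom.lin h) x)

/-- An injective homomorphism is a kernel of any homomorphism with the right null space. -/
def isLimitOfInjective {M N P : RightComodule K C} (f : M ⟶ N) (g : N ⟶ P) (w : f ≫ g = 0)
    (hf : Function.Injective f.lin) (h : LinearMap.ker g.lin ≤ LinearMap.range f.lin) :
    IsLimit (KernelFork.ofι f w) :=
  haveI := mono_of_injective f hf
  KernelFork.IsLimit.ofι' f w fun k hk =>
    ⟨liftInj f hf k (fun x => h (LinearMap.congr_fun (congrArg Hom.lin hk) x)),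
      liftInj_fac _ _ _ _⟩

/-- A surjective homomorphism is a cokernel of any homomorphism with the right range. -/
def isColimitOfSurjective {M N P : RightComodule K C} (f : M ⟶ N) (g : N ⟶ P) (w : f ≫ g = 0)
    (hg : Function.Surjective g.lin) (h : LinearMap.ker g.lin ≤ LinearMap.range f.lin) :
    IsColimit (CokernelCofork.ofπ g w) :=
  haveI := epi_of_surjective g hg
  CokernelCofork.IsColimit.ofπ' g w fun k hk =>
    ⟨descSurj g hg k (fun x hx => by
      obtain ⟨y, rfl⟩ := h hx
      exact LinearMap.congr_fun (congrArg Hom.lin hk) y), descSurj_fac _ _ _ _⟩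

theorem subι_ker_comp {M N : RightComodule K C} (f : M ⟶ N) :
    M.subι _ (isSubcomodule_ker f) ≫ f = 0 := by
  ext x; exact x.2

theorem comp_quotπ_range {M N : RightComodule K C} (f : M ⟶ N) :
    f ≫ N.quotπ _ (isSubcomodule_range f) = 0 := by
  ext x; exact (Submodule.Quotient.mk_eq_zero _).2 ⟨x, rfl⟩

instance : HasKernels (RightComodule K C) where
  has_limit f := ⟨⟨_, isLimitOfInjective _ f (subι_ker_comp f) (Submodule.injective_subtype _)
    (fun x hx => ⟨⟨x, hx⟩, rfl⟩)⟩⟩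

instance : HasCokernels (RightComodule K C) where
  has_colimit f := ⟨⟨_, isColimitOfSurjective f _ (comp_quotπ_range f)
    (Submodule.mkQ_surjective _) (fun _ hx => (Submodule.Quotient.mk_eq_zero _).1 hx)⟩⟩

instance : IsNormalMonoCategory (RightComodule K C) where
  normalMonoOfMono f _ := ⟨⟨_, _, comp_quotπ_range f, isLimitOfInjective f _ _
    (injective_of_mono f) (fun _ hx => (Submodule.Quotient.mk_eq_zero _).1 hx)⟩⟩

instance : IsNormalEpiCategory (RightComodule K C) where
  normalEpiOfEpi f _ := ⟨⟨_, _, subι_ker_comp f, isColimitOfSurjective _ f _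
    (surjective_of_epi f) (fun x hx => ⟨⟨x, hx⟩, rfl⟩)⟩⟩

/-- The zero comodule. -/
def zeroComodule : RightComodule K C where
  carrier := PUnit.{t + 1}
  coact := 0
  coassoc := LinearMap.ext fun _ => by simp
  counit := LinearMap.ext fun x => by
    rw [Subsingleton.elim x 0, map_zero, map_zero]

/-- The structure map of a direct sum of comodules. -/
def prodCoact (M N : RightComodule K C) : M × N →ₗ[K] (M × N) ⊗[K] C :=
  LinearMap.coprod ((LinearMap.inl K M N).rTensor C ∘ₗ M.coact)
    ((LinearMap.inr K M N).rTensor C ∘ₗ N.coact)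

theorem prodCoact_fst (M N : RightComodule K C) :
    M.coact ∘ₗ LinearMap.fst K M N = (LinearMap.fst K M N).rTensor C ∘ₗ M.prodCoact N := by
  refine LinearMap.prod_ext ?_ ?_
  · rw [prodCoact, LinearMap.comp_assoc, LinearMap.comp_assoc, LinearMap.coprod_inl,
      ← LinearMap.comp_assoc M.coact, ← LinearMap.rTensor_comp, LinearMap.fst_comp_inl]
    simp
  · rw [prodCoact, LinearMap.comp_assoc, LinearMap.comp_assoc, LinearMap.coprod_inr,
      ← LinearMap.comp_assoc N.coact, ← LinearMap.rTensor_comp, LinearMap.fst_comp_inr]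
    simp

theorem prodCoact_snd (M N : RightComodule K C) :
    N.coact ∘ₗ LinearMap.snd K M N = (LinearMap.snd K M N).rTensor C ∘ₗ M.prodCoact N := by
  refine LinearMap.prod_ext ?_ ?_
  · rw [prodCoact, LinearMap.comp_assoc, LinearMap.comp_assoc, LinearMap.coprod_inl,
      ← LinearMap.comp_assoc M.coact, ← LinearMap.rTensor_comp, LinearMap.snd_comp_inl]
    simp
  · rw [prodCoact, LinearMap.comp_assoc, LinearMap.comp_assoc, LinearMap.coprod_inr,
      ← LinearMap.comp_assoc N.coact, ← LinearMap.rTensor_comp, LinearMap.snd_comp_inr]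
    simp

/-- The direct sum of two comodules. -/
def prod (M N : RightComodule K C) : RightComodule K C where
  carrier := M × N
  coact := M.prodCoact N
  coassoc := LinearMap.prod_ext (coassoc_comp M _ _ (LinearMap.coprod_inl _ _))
    (coassoc_comp N _ _ (LinearMap.coprod_inr _ _))
  counit := LinearMap.prod_ext (counit_comp M _ _ (LinearMap.coprod_inl _ _))
    (counit_comp N _ _ (LinearMap.coprod_inr _ _))

/-- The binary biproduct diagram of two comodules. -/
def prodBicone (M N : RightComodule K C) : BinaryBicone M N where
  pt := M.prod N
  fst := ⟨LinearMap.fst K M N, M.prodCoact_fst N⟩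
  snd := ⟨LinearMap.snd K M N, M.prodCoact_snd N⟩
  inl := ⟨LinearMap.inl K M N, LinearMap.coprod_inl _ _⟩
  inr := ⟨LinearMap.inr K M N, LinearMap.coprod_inr _ _⟩
  inl_fst := by ext x; rfl
  inl_snd := by ext x; rfl
  inr_fst := by ext x; rfl
  inr_snd := by ext x; rfl

theorem prod_fst_add_snd (M N : RightComodule K C) (x : M × N) :
    LinearMap.inl K M N (LinearMap.fst K M N x) + LinearMap.inr K M N (LinearMap.snd K M N x) =
      x := by
  simp

theorem isZero_zeroComodule : IsZero (zeroComodule : RightComodule K C) := by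
  rw [IsZero.iff_id_eq_zero]
  ext x; rfl

instance : HasFiniteProducts (RightComodule K C) :=
  haveI : HasZeroObject (RightComodule K C) := ⟨zeroComodule, isZero_zeroComodule⟩
  haveI : HasBinaryBiproducts (RightComodule K C) := ⟨fun M N =>
    hasBinaryBiproduct_of_total (prodBicone M N)
      (hom_ext (LinearMap.ext (prod_fst_add_snd M N)))⟩
  hasFiniteProducts_of_has_binary_and_terminal

/-- Comodules over a coalgebra over a field form an abelian category. -/
instance : Abelian (RightComodule K C) where

/-! ### The action of the dual algebra and quasifinite comodules -/

/-- The left action `f · m = ∑ m₍₀₎ f(m₍₁₎)` of a functional `f` on a right comodule. -/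
def act (M : RightComodule K C) (f : C →ₗ[K] K) : M →ₗ[K] M :=
  (TensorProduct.rid K M).toLinearMap ∘ₗ f.lTensor M ∘ₗ M.coact

theorem act_lin {M N : RightComodule K C} (g : M ⟶ N) (f : C →ₗ[K] K) (m : M) :
    N.act f (g.lin m) = g.lin (M.act f m) := by
  have h : ∀ z : M ⊗[K] C, TensorProduct.rid K N (f.lTensor N (g.lin.rTensor C z)) =
      g.lin (TensorProduct.rid K M (f.lTensor M z)) := by
    intro z
    induction z with
    | zero => simp
    | tmul x y => simp
    | add x y hx hy => simp only [map_add, hx, hy]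
  simpa [act, lin_coact] using h (M.coact m)

/-- A right comodule `M` is quasifinite if `Hom(S, M)` is finite-dimensional for every simple
right comodule `S`. -/
def IsQuasifinite (M : RightComodule K C) : Prop :=
  ∀ S : RightComodule K C, Simple S → Module.Finite K (S ⟶ M)

end RightComodule

/-! ### Colocalizing subcategories -/

/-- A dense (that is, Serre) subcategory of an abelian category is colocalizing if the quotient
functor has a left adjoint. The quotient category is the localization with respect to the
morphisms whose kernel and cokernel lie in the subcategory. -/
def IsColocalizing {A : Type*} [Category A] [Abelian A] (P : ObjectProperty A)
    [P.IsSerreClass] : Prop :=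
  P.isoModSerre.Q.IsRightAdjoint

/-! ### Idempotents of the dual algebra, localized coalgebras -/

/-- An idempotent of the dual algebra `C^*` (with the convolution product). -/
structure DualIdempotent (K : Type u) [Field K] (C : Type t) [AddCommGroup C] [Module K C]
    [Coalgebra K C] where
  fn : C →ₗ[K] K
  idem : IsIdempotentElem (WithConv.toConv fn)

namespace DualIdempotent

variable {K : Type u} [Field K] {C : Type t} [AddCommGroup C] [Module K C] [Coalgebra K C]
  (e : DualIdempotent K C)

/-- `c ↦ e c = ∑ c₍₁₎ e(c₍₂₎)` -/
def leftMul : C →ₗ[K] C :=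
  (TensorProduct.rid K C).toLinearMap ∘ₗ e.fn.lTensor C ∘ₗ Coalgebra.comul

/-- `c ↦ c e = ∑ e(c₍₁₎) c₍₂₎` -/
def rightMul : C →ₗ[K] C :=
  (TensorProduct.lid K C).toLinearMap ∘ₗ e.fn.rTensor C ∘ₗ Coalgebra.comul

theorem idem_apply (c : C) :
    LinearMap.mul' K K (TensorProduct.map e.fn e.fn (Coalgebra.comul c)) = e.fn c :=
  LinearMap.congr_fun (congrArg WithConv.ofConv e.idem) c

theorem fn_leftMul : e.fn ∘ₗ e.leftMul = e.fn := by
  ext c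
  rw [← e.idem_apply c]
  simp only [leftMul, LinearMap.comp_apply, LinearEquiv.coe_coe]
  induction (Coalgebra.comul (R := K) c) with
  | zero => simp
  | tmul x y => simp [mul_comm]
  | add x y hx hy => simp only [map_add, hx, hy]

theorem fn_rightMul : e.fn ∘ₗ e.rightMul = e.fn := by
  ext c
  rw [← e.idem_apply c]
  simp only [rightMul, LinearMap.comp_apply, LinearEquiv.coe_coe]
  induction (Coalgebra.comul (R := K) c) with
  | zero => simp
  | tmul x y => simp
  | add x y hx hy => simp only [map_add, hx, hy]

theorem counit_leftMul : Coalgebra.counit ∘ₗ e.leftMul = e.fn := by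
  ext c
  have h : ∀ z : C ⊗[K] C, Coalgebra.counit (R := K)
      (TensorProduct.rid K C (e.fn.lTensor C z)) =
      e.fn (TensorProduct.lid K C ((Coalgebra.counit (R := K)).rTensor C z)) := by
    intro z
    induction z with
    | zero => simp
    | tmul x y => simp [mul_comm]
    | add x y hx hy => simp only [map_add, hx, hy]
  exact (h (Coalgebra.comul c)).trans (by simp)

theorem counit_rightMul : Coalgebra.counit ∘ₗ e.rightMul = e.fn := by
  ext c
  have h : ∀ z : C ⊗[K] C, Coalgebra.counit (R := K)
      (TensorProduct.lid K C (e.fn.rTensor C z)) =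
      e.fn (TensorProduct.rid K C ((Coalgebra.counit (R := K)).lTensor C z)) := by
    intro z
    induction z with
    | zero => simp
    | tmul x y => simp [mul_comm]
    | add x y hx hy => simp only [map_add, hx, hy]
  exact (h (Coalgebra.comul c)).trans (by simp)

theorem comul_leftMul :
    Coalgebra.comul ∘ₗ e.leftMul = e.leftMul.lTensor C ∘ₗ Coalgebra.comul (R := K) := by
  have h0 : ∀ (u : C ⊗[K] C) (b : C),
      ((TensorProduct.rid K C).toLinearMap ∘ₗ e.fn.lTensor C).lTensor C
        (TensorProduct.assoc K C C C (u ⊗ₜ b)) = e.fn b • u := by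
    intro u b
    induction u with
    | zero => simp
    | tmul x y => simp
    | add x y hx hy => simp only [TensorProduct.add_tmul, map_add, hx, hy, smul_add]
  have h : ∀ z : C ⊗[K] C, Coalgebra.comul (R := K)
      (TensorProduct.rid K C (e.fn.lTensor C z)) =
      ((TensorProduct.rid K C).toLinearMap ∘ₗ e.fn.lTensor C).lTensor C
        (TensorProduct.assoc K C C C (Coalgebra.comul.rTensor C z)) := by
    intro z
    induction z with
    | zero => simp
    | tmul x y => rw [LinearMap.rTensor_tmul, h0]; simp
    | add x y hx hy => simp only [map_add, hx, hy]
  ext c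
  have := h (Coalgebra.comul c)
  rw [Coalgebra.coassoc_apply, ← LinearMap.lTensor_comp_apply] at this
  exact this

theorem comul_rightMul :
    Coalgebra.comul ∘ₗ e.rightMul = e.rightMul.rTensor C ∘ₗ Coalgebra.comul (R := K) := by
  have h0 : ∀ (u : C ⊗[K] C) (b : C),
      ((TensorProduct.lid K C).toLinearMap ∘ₗ e.fn.rTensor C).rTensor C
        ((TensorProduct.assoc K C C C).symm (b ⊗ₜ u)) = e.fn b • u := by
    intro u b
    induction u with
    | zero => simp
    | tmul x y => simp [TensorProduct.smul_tmul']
    | add x y hx hy => simp only [TensorProduct.tmul_add, map_add, hx, hy, smul_add]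
  have h : ∀ z : C ⊗[K] C, Coalgebra.comul (R := K)
      (TensorProduct.lid K C (e.fn.rTensor C z)) =
      ((TensorProduct.lid K C).toLinearMap ∘ₗ e.fn.rTensor C).rTensor C
        ((TensorProduct.assoc K C C C).symm (Coalgebra.comul.lTensor C z)) := by
    intro z
    induction z with
    | zero => simp
    | tmul x y => rw [LinearMap.lTensor_tmul, h0]; simp
    | add x y hx hy => simp only [map_add, hx, hy]
  ext c
  have := h (Coalgebra.comul c)
  rw [Coalgebra.coassoc_symm_apply, ← LinearMap.rTensor_comp_apply] at this
  exact this

theorem leftMul_leftMul : e.leftMul ∘ₗ e.leftMul = e.leftMul := by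
  conv_lhs => enter [1]; rw [leftMul]
  rw [LinearMap.comp_assoc, LinearMap.comp_assoc, e.comul_leftMul,
    ← LinearMap.comp_assoc Coalgebra.comul, ← LinearMap.lTensor_comp, e.fn_leftMul]
  rfl

theorem rightMul_rightMul : e.rightMul ∘ₗ e.rightMul = e.rightMul := by
  conv_lhs => enter [1]; rw [rightMul]
  rw [LinearMap.comp_assoc, LinearMap.comp_assoc, e.comul_rightMul,
    ← LinearMap.comp_assoc Coalgebra.comul, ← LinearMap.rTensor_comp, e.fn_rightMul]
  rfl

theorem rightMul_leftMul : e.rightMul ∘ₗ e.leftMul = e.leftMul ∘ₗ e.rightMul := by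
  have h : ∀ z : C ⊗[K] C, TensorProduct.lid K C (e.fn.rTensor C (e.leftMul.lTensor C z)) =
      e.leftMul (TensorProduct.lid K C (e.fn.rTensor C z)) := by
    intro z
    induction z with
    | zero => simp
    | tmul x y => simp
    | add x y hx hy => simp only [map_add, hx, hy]
  conv_lhs => enter [1]; rw [rightMul]
  rw [LinearMap.comp_assoc, LinearMap.comp_assoc, e.comul_leftMul]
  ext c
  exact h (Coalgebra.comul c)

/-- The subspace `eC` of `C`. -/
def left : Submodule K C := LinearMap.range e.leftMul

/-- The subspace `eCe` of `C`. -/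
def corner : Submodule K C := LinearMap.range (e.rightMul ∘ₗ e.leftMul)

/-- `c ↦ e c`, as a map onto `eC`. -/
def toLeft : C →ₗ[K] e.left := e.leftMul.rangeRestrict

/-- `c ↦ e c e`, as a map onto `eCe`. -/
def toCorner : C →ₗ[K] e.corner := (e.rightMul ∘ₗ e.leftMul).rangeRestrict

theorem toLeft_surjective : Function.Surjective e.toLeft := LinearMap.surjective_rangeRestrict _

theorem toCorner_surjective : Function.Surjective e.toCorner :=
  LinearMap.surjective_rangeRestrict _

theorem toLeft_leftMul : e.toLeft ∘ₗ e.leftMul = e.toLeft := by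
  ext c
  exact LinearMap.congr_fun e.leftMul_leftMul c

theorem toCorner_leftMul : e.toCorner ∘ₗ e.leftMul = e.toCorner := by
  ext c
  exact congrArg e.rightMul (LinearMap.congr_fun e.leftMul_leftMul c)

theorem toCorner_rightMul : e.toCorner ∘ₗ e.rightMul = e.toCorner := by
  ext c
  change e.rightMul ((e.leftMul ∘ₗ e.rightMul) c) = e.rightMul (e.leftMul c)
  rw [← e.rightMul_leftMul]
  exact LinearMap.congr_fun e.rightMul_rightMul (e.leftMul c)

theorem subtype_toLeft : e.left.subtype ∘ₗ e.toLeft = e.leftMul := rfl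

theorem subtype_toCorner : e.corner.subtype ∘ₗ e.toCorner = e.rightMul ∘ₗ e.leftMul := rfl

/-- `Δ(x) = ∑ e x₍₁₎ e ⊗ e x₍₂₎ e` on `eCe`; the counit is the restriction of that of `C`. -/
instance : CoalgebraStruct K e.corner where
  comul := TensorProduct.map e.toCorner e.toCorner ∘ₗ Coalgebra.comul ∘ₗ e.corner.subtype
  counit := Coalgebra.counit ∘ₗ e.corner.subtype

theorem corner_comul : Coalgebra.comul (R := K) (A := e.corner) =
    TensorProduct.map e.toCorner e.toCorner ∘ₗ Coalgebra.comul ∘ₗ e.corner.subtype := rfl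

theorem corner_counit : Coalgebra.counit (R := K) (A := e.corner) =
    Coalgebra.counit ∘ₗ e.corner.subtype := rfl

theorem corner_comul_toCorner : Coalgebra.comul (R := K) (A := e.corner) ∘ₗ e.toCorner =
    TensorProduct.map e.toCorner e.toCorner ∘ₗ Coalgebra.comul := by
  rw [corner_comul, LinearMap.comp_assoc, LinearMap.comp_assoc, subtype_toCorner,
    ← LinearMap.comp_assoc e.leftMul, comul_rightMul, LinearMap.comp_assoc, comul_leftMul,
    ← LinearMap.comp_assoc, ← LinearMap.comp_assoc, LinearMap.map_comp_rTensor,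
    LinearMap.map_comp_lTensor, toCorner_leftMul, toCorner_rightMul]

theorem corner_counit_toCorner :
    Coalgebra.counit (R := K) (A := e.corner) ∘ₗ e.toCorner = e.fn := by
  rw [corner_counit, LinearMap.comp_assoc, subtype_toCorner, ← LinearMap.comp_assoc,
    counit_rightMul, fn_leftMul]

/-- The localized coalgebra `eCe`. -/
instance : Coalgebra K e.corner where
  coassoc := by
    refine (LinearMap.cancel_right e.toCorner_surjective).1 ?_
    have h : (TensorProduct.assoc K e.corner e.corner e.corner).toLinearMap ∘ₗ
        TensorProduct.map (TensorProduct.map e.toCorner e.toCorner) e.toCorner =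
        TensorProduct.map e.toCorner (TensorProduct.map e.toCorner e.toCorner) ∘ₗ
          (TensorProduct.assoc K C C C).toLinearMap := by
      ext; simp
    rw [LinearMap.comp_assoc, LinearMap.comp_assoc, corner_comul_toCorner, LinearMap.comp_assoc,
      corner_comul_toCorner, ← LinearMap.comp_assoc Coalgebra.comul,
      ← LinearMap.comp_assoc Coalgebra.comul (TensorProduct.map e.toCorner e.toCorner)
        (Coalgebra.comul.lTensor _), LinearMap.rTensor_comp_map,
      LinearMap.lTensor_comp_map, corner_comul_toCorner,
      ← LinearMap.map_comp_rTensor, ← LinearMap.map_comp_lTensor, LinearMap.comp_assoc,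
      LinearMap.comp_assoc, ← LinearMap.comp_assoc _ (TensorProduct.map _ _), h,
      LinearMap.comp_assoc, Coalgebra.coassoc]
  rTensor_counit_comp_comul := by
    refine (LinearMap.cancel_right e.toCorner_surjective).1 ?_
    rw [LinearMap.comp_assoc, corner_comul_toCorner, ← LinearMap.comp_assoc,
      LinearMap.rTensor_comp_map, corner_counit_toCorner]
    ext c
    have h : ∀ z : C ⊗[K] C, TensorProduct.map e.fn e.toCorner z =
        1 ⊗ₜ e.toCorner (TensorProduct.lid K C (e.fn.rTensor C z)) := by
      intro z
      induction z with
      | zero => simp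
      | tmul x y =>
        rw [LinearMap.rTensor_tmul, TensorProduct.lid_tmul, map_smul, TensorProduct.map_tmul,
          ← TensorProduct.smul_tmul, smul_eq_mul, mul_one]
      | add x y hx hy => simp only [map_add, hx, hy, TensorProduct.tmul_add]
    exact (h _).trans (congrArg _ (LinearMap.congr_fun e.toCorner_rightMul c))
  lTensor_counit_comp_comul := by
    refine (LinearMap.cancel_right e.toCorner_surjective).1 ?_
    rw [LinearMap.comp_assoc, corner_comul_toCorner, ← LinearMap.comp_assoc,
      LinearMap.lTensor_comp_map, corner_counit_toCorner]
    ext c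
    have h : ∀ z : C ⊗[K] C, TensorProduct.map e.toCorner e.fn z =
        e.toCorner (TensorProduct.rid K C (e.fn.lTensor C z)) ⊗ₜ 1 := by
      intro z
      induction z with
      | zero => simp
      | tmul x y => simp [TensorProduct.smul_tmul]
      | add x y hx hy => simp only [map_add, hx, hy, TensorProduct.add_tmul]
    exact (h _).trans (congrArg (· ⊗ₜ[K] (1 : K)) (LinearMap.congr_fun e.toCorner_leftMul c))

/-- The structure map `ρ(p) = ∑ e p₍₁₎ ⊗ e p₍₂₎ e` of `eC`. -/
def leftCoact : e.left →ₗ[K] e.left ⊗[K] e.corner :=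
  TensorProduct.map e.toLeft e.toCorner ∘ₗ Coalgebra.comul ∘ₗ e.left.subtype

theorem leftCoact_toLeft : e.leftCoact ∘ₗ e.toLeft =
    TensorProduct.map e.toLeft e.toCorner ∘ₗ Coalgebra.comul := by
  rw [leftCoact, LinearMap.comp_assoc, LinearMap.comp_assoc, subtype_toLeft, comul_leftMul,
    ← LinearMap.comp_assoc, LinearMap.map_comp_lTensor, toCorner_leftMul]

/-- The right `eCe`-comodule `eC`. -/
def leftComodule : RightComodule K e.corner where
  carrier := e.left
  coact := e.leftCoact
  coassoc := by
    refine (LinearMap.cancel_right e.toLeft_surjective).1 ?_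
    have h : (TensorProduct.assoc K e.left e.corner e.corner).toLinearMap ∘ₗ
        TensorProduct.map (TensorProduct.map e.toLeft e.toCorner) e.toCorner =
        TensorProduct.map e.toLeft (TensorProduct.map e.toCorner e.toCorner) ∘ₗ
          (TensorProduct.assoc K C C C).toLinearMap := by
      ext; simp
    rw [LinearMap.comp_assoc, LinearMap.comp_assoc, leftCoact_toLeft, LinearMap.comp_assoc,
      leftCoact_toLeft, ← LinearMap.comp_assoc Coalgebra.comul,
      ← LinearMap.comp_assoc Coalgebra.comul (TensorProduct.map e.toLeft e.toCorner)
        (Coalgebra.comul.lTensor _), LinearMap.rTensor_comp_map,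
      LinearMap.lTensor_comp_map, leftCoact_toLeft, corner_comul_toCorner,
      ← LinearMap.map_comp_rTensor, ← LinearMap.map_comp_lTensor, LinearMap.comp_assoc,
      LinearMap.comp_assoc, ← LinearMap.comp_assoc _ (TensorProduct.map _ _), h,
      LinearMap.comp_assoc, Coalgebra.coassoc]
  counit := by
    refine (LinearMap.cancel_right e.toLeft_surjective).1 ?_
    rw [LinearMap.comp_assoc, leftCoact_toLeft, ← LinearMap.comp_assoc,
      LinearMap.lTensor_comp_map, corner_counit_toCorner]
    ext c
    have h : ∀ z : C ⊗[K] C, TensorProduct.map e.toLeft e.fn z =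
        e.toLeft (TensorProduct.rid K C (e.fn.lTensor C z)) ⊗ₜ 1 := by
      intro z
      induction z with
      | zero => simp
      | tmul x y => simp [TensorProduct.smul_tmul]
      | add x y hx hy => simp only [map_add, hx, hy, TensorProduct.add_tmul]
    exact (h _).trans (congrArg (· ⊗ₜ[K] (1 : K)) (LinearMap.congr_fun e.toLeft_leftMul c))

/-- The localizing subcategory `T_e` of the category of right `C`-comodules: it consists of the
comodules `M` with `e M = 0`. -/
def localizingSubcategory : ObjectProperty (RightComodule K C) :=
  fun M => ∀ m : M, M.act e.fn m = 0

theorem act_act (M : RightComodule K C) (m : M) :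
    M.act e.fn (M.act e.fn m) = M.act e.fn m := by
  have h0 : ∀ (u : M ⊗[K] C) (b : C),
      TensorProduct.rid K M (e.fn.lTensor M (((TensorProduct.rid K C).toLinearMap ∘ₗ
        e.fn.lTensor C).lTensor M (TensorProduct.assoc K M C C (u ⊗ₜ b)))) =
        e.fn b • TensorProduct.rid K M (e.fn.lTensor M u) := by
    intro u b
    induction u with
    | zero => simp
    | tmul x y => simp
    | add x y hx hy => simp only [TensorProduct.add_tmul, map_add, hx, hy, smul_add]
  have h : ∀ z : M ⊗[K] C, M.act e.fn (TensorProduct.rid K M (e.fn.lTensor M z)) =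
      TensorProduct.rid K M (e.fn.lTensor M (((TensorProduct.rid K C).toLinearMap ∘ₗ
        e.fn.lTensor C).lTensor M (TensorProduct.assoc K M C C (M.coact.rTensor C z)))) := by
    intro z
    induction z with
    | zero => simp
    | tmul x y => rw [LinearMap.rTensor_tmul, h0]; simp [RightComodule.act]
    | add x y hx hy => simp only [map_add, hx, hy]
  have h2 := h (M.coact m)
  have h3 := LinearMap.congr_fun M.coassoc m
  simp only [LinearMap.comp_apply, LinearEquiv.coe_coe] at h3
  rw [h3, ← LinearMap.lTensor_comp_apply, ← LinearMap.lTensor_comp_apply] at h2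
  change M.act e.fn (M.act e.fn m) = TensorProduct.rid K M ((e.fn ∘ₗ e.leftMul).lTensor M _) at h2
  rw [e.fn_leftMul] at h2
  exact h2

instance : e.localizingSubcategory.IsSerreClass where
  exists_zero := ⟨RightComodule.zeroComodule, RightComodule.isZero_zeroComodule, fun _ => rfl⟩
  prop_of_mono {M N} f _ hN m := RightComodule.injective_of_mono f (by
    rw [map_zero, ← RightComodule.act_lin, hN])
  prop_of_epi {M N} f _ hM n := by
    obtain ⟨m, rfl⟩ := RightComodule.surjective_of_epi f n
    rw [RightComodule.act_lin, hM, map_zero]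
  prop_X₂_of_shortExact {S} hS h₁ h₃ m := by
    have := hS.mono_f
    obtain ⟨n, hn⟩ : S.X₂.act e.fn m ∈ LinearMap.range S.f.lin := by
      have hk : S.g.lin (S.X₂.act e.fn m) = 0 := by rw [← RightComodule.act_lin, h₃]
      refine ⟨(hS.fIsKernel.lift (KernelFork.ofι _ (RightComodule.subι_ker_comp S.g))).lin
        ⟨_, hk⟩, ?_⟩
      have := hS.fIsKernel.fac (KernelFork.ofι _ (RightComodule.subι_ker_comp S.g))
        WalkingParallelPair.zero
      exact LinearMap.congr_fun (congrArg RightComodule.Hom.lin this) ⟨_, hk⟩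
    rw [← e.act_act, ← hn, RightComodule.act_lin, h₁, map_zero]

end DualIdempotent

/-! ### Subcoalgebras -/

/-- A subcoalgebra of a coalgebra `A`: a subspace `D` with `Δ(D) ⊆ D ⊗ D`. -/
structure Subcoalgebra (K : Type u) [Field K] (A : Type t) [AddCommGroup A] [Module K A]
    [Coalgebra K A] where
  toSubmodule : Submodule K A
  comul_mem : ∀ c ∈ toSubmodule, Coalgebra.comul (R := K) c ∈
    LinearMap.range (TensorProduct.map toSubmodule.subtype toSubmodule.subtype)

namespace Subcoalgebra

variable {K : Type u} [Field K] {A : Type t} [AddCommGroup A] [Module K A] [Coalgebra K A]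
  (D : Subcoalgebra K A)

theorem map_subtype_injective :
    Function.Injective (TensorProduct.map D.toSubmodule.subtype D.toSubmodule.subtype) :=
  TensorProduct.map_injective_of_flat_flat _ _ D.toSubmodule.injective_subtype
    D.toSubmodule.injective_subtype

/-- The comultiplication and the counit of a subcoalgebra are the restricted ones. -/
instance : CoalgebraStruct K D.toSubmodule where
  comul := (LinearEquiv.ofInjective _ D.map_subtype_injective).symm.toLinearMap ∘ₗ
    (Coalgebra.comul ∘ₗ D.toSubmodule.subtype).codRestrict _ (fun c => D.comul_mem c c.2)
  counit := Coalgebra.counit ∘ₗ D.toSubmodule.subtype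

theorem map_subtype_comul : TensorProduct.map D.toSubmodule.subtype D.toSubmodule.subtype ∘ₗ
    Coalgebra.comul = Coalgebra.comul (R := K) ∘ₗ D.toSubmodule.subtype := by
  ext c
  exact congrArg Subtype.val (LinearEquiv.apply_symm_apply
    (LinearEquiv.ofInjective _ D.map_subtype_injective)
    ((Coalgebra.comul ∘ₗ D.toSubmodule.subtype).codRestrict _ (fun c => D.comul_mem c c.2) c))

theorem counit_subtype : Coalgebra.counit (R := K) (A := D.toSubmodule) =
    Coalgebra.counit ∘ₗ D.toSubmodule.subtype := rfl

instance : Coalgebra K D.toSubmodule where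
  coassoc := by
    have hinj : Function.Injective (TensorProduct.map D.toSubmodule.subtype
        (TensorProduct.map D.toSubmodule.subtype D.toSubmodule.subtype)) :=
      TensorProduct.map_injective_of_flat_flat _ _ D.toSubmodule.injective_subtype
        D.map_subtype_injective
    have h : (TensorProduct.assoc K A A A).toLinearMap ∘ₗ
        TensorProduct.map (TensorProduct.map D.toSubmodule.subtype D.toSubmodule.subtype)
          D.toSubmodule.subtype =
        TensorProduct.map D.toSubmodule.subtype
          (TensorProduct.map D.toSubmodule.subtype D.toSubmodule.subtype) ∘ₗ
          (TensorProduct.assoc K _ _ _).toLinearMap := by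
      ext; simp
    have h1 : TensorProduct.map (TensorProduct.map D.toSubmodule.subtype D.toSubmodule.subtype)
          D.toSubmodule.subtype ∘ₗ Coalgebra.comul.rTensor D.toSubmodule =
        Coalgebra.comul.rTensor A ∘ₗ
          TensorProduct.map D.toSubmodule.subtype D.toSubmodule.subtype := by
      rw [LinearMap.map_comp_rTensor, map_subtype_comul, LinearMap.rTensor_comp_map]
    have h2 : TensorProduct.map D.toSubmodule.subtype
          (TensorProduct.map D.toSubmodule.subtype D.toSubmodule.subtype) ∘ₗ
          Coalgebra.comul.lTensor D.toSubmodule =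
        Coalgebra.comul.lTensor A ∘ₗ
          TensorProduct.map D.toSubmodule.subtype D.toSubmodule.subtype := by
      rw [LinearMap.map_comp_lTensor, map_subtype_comul, LinearMap.lTensor_comp_map]
    refine (LinearMap.cancel_left hinj).1 ?_
    rw [← LinearMap.comp_assoc, ← h, LinearMap.comp_assoc,
      ← LinearMap.comp_assoc _ (LinearMap.rTensor _ _) (TensorProduct.map _ _), h1,
      ← LinearMap.comp_assoc _ (LinearMap.lTensor _ _) (TensorProduct.map _ _), h2,
      LinearMap.comp_assoc, map_subtype_comul, LinearMap.comp_assoc, map_subtype_comul,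
      ← LinearMap.comp_assoc, ← LinearMap.comp_assoc, ← LinearMap.comp_assoc,
      LinearMap.comp_assoc Coalgebra.comul, Coalgebra.coassoc]
  rTensor_counit_comp_comul := by
    have hinj : Function.Injective (D.toSubmodule.subtype.lTensor K) :=
      Module.Flat.lTensor_preserves_injective_linearMap _ D.toSubmodule.injective_subtype
    refine (LinearMap.cancel_left hinj).1 ?_
    rw [counit_subtype, ← LinearMap.comp_assoc, LinearMap.lTensor_comp_rTensor,
      ← LinearMap.rTensor_comp_map, LinearMap.comp_assoc, map_subtype_comul,
      ← LinearMap.comp_assoc, Coalgebra.rTensor_counit_comp_comul]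
    ext; simp
  lTensor_counit_comp_comul := by
    have hinj : Function.Injective (D.toSubmodule.subtype.rTensor K) :=
      Module.Flat.rTensor_preserves_injective_linearMap _ D.toSubmodule.injective_subtype
    refine (LinearMap.cancel_left hinj).1 ?_
    rw [counit_subtype, ← LinearMap.comp_assoc, LinearMap.rTensor_comp_lTensor,
      ← LinearMap.lTensor_comp_map, LinearMap.comp_assoc, map_subtype_comul,
      ← LinearMap.comp_assoc, Coalgebra.lTensor_counit_comp_comul]
    ext; simp

end Subcoalgebra

/-! ### The path coalgebra of a quiver -/

/-- The vector space `KQ` with basis the set of all paths of the quiver `V`. -/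
def PathCoalgebra (K : Type u) [Field K] (V : Type v) [Quiver.{w} V] : Type (max u v w) :=
  (Σ a b : V, Quiver.Path a b) →₀ K

namespace PathCoalgebra

variable {K : Type u} [Field K] {V : Type v} [Quiver.{w} V]

instance : AddCommGroup (PathCoalgebra K V) :=
  inferInstanceAs (AddCommGroup ((Σ a b : V, Quiver.Path a b) →₀ K))

instance : Module K (PathCoalgebra K V) :=
  inferInstanceAs (Module K ((Σ a b : V, Quiver.Path a b) →₀ K))

variable (K) in
/-- A path, as an element of `KQ`. -/
def of {a b : V} (p : Quiver.Path a b) : PathCoalgebra K V := Finsupp.single ⟨a, b, p⟩ 1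

/-- The linear map on `KQ` with prescribed values on the paths. -/
def lift {M : Type*} [AddCommGroup M] [Module K M] (F : ∀ a b : V, Quiver.Path a b → M) :
    PathCoalgebra K V →ₗ[K] M :=
  Finsupp.linearCombination K fun p : Σ a b : V, Quiver.Path a b => F p.1 p.2.1 p.2.2

@[simp]
theorem lift_of {M : Type*} [AddCommGroup M] [Module K M] (F : ∀ a b : V, Quiver.Path a b → M)
    {a b : V} (p : Quiver.Path a b) : lift F (of K p) = F a b p := by
  exact (Finsupp.linearCombination_single K 1 _).trans (one_smul K _)

theorem linearMap_ext {M : Type*} [AddCommGroup M] [Module K M]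
    {f g : PathCoalgebra K V →ₗ[K] M}
    (h : ∀ (a b : V) (p : Quiver.Path a b), f (of K p) = g (of K p)) : f = g :=
  Finsupp.lhom_ext' fun p => LinearMap.ext_ring (h p.1 p.2.1 p.2.2)

/-- The list of all decompositions of a path `p` into an initial part and a final part. -/
def splittings {a : V} : ∀ {b : V}, Quiver.Path a b →
    List (Σ c : V, Quiver.Path a c × Quiver.Path c b)
  | _, .nil => [⟨a, .nil, .nil⟩]
  | _, .cons p α => ⟨_, .cons p α, .nil⟩ ::
      (splittings p).map fun s => ⟨s.1, s.2.1, .cons s.2.2 α⟩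

theorem mem_splittings {a b : V} (p : Quiver.Path a b)
    (s : Σ c : V, Quiver.Path a c × Quiver.Path c b) :
    s ∈ splittings p ↔ s.2.1.comp s.2.2 = p := by
  induction p with
  | nil =>
    obtain ⟨c, τ, η⟩ := s
    cases η with
    | nil =>
      constructor
      · intro h
        simp only [splittings, List.mem_singleton] at h
        cases h
        rfl
      · intro h
        simp at h
        subst h
        simp [splittings]
    | cons η α =>
      constructor
      · intro h
        simp only [splittings, List.mem_singleton] at h
        cases h
      · intro h
        cases h
  | cons p α ih =>
    obtain ⟨c, τ, η⟩ := s
    simp only [splittings, List.mem_cons, List.mem_map]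
    constructor
    · rintro (h | ⟨r, hr, h⟩)
      · cases h
        rfl
      · cases h
        simp only [Quiver.Path.comp_cons, (ih r).1 hr]
    · intro h
      cases η with
      | nil =>
        left
        simp at h
        subst h
        rfl
      | cons η β =>
        right
        simp only [Quiver.Path.comp_cons] at h
        cases h
        exact ⟨⟨c, τ, η⟩, (ih _).2 rfl, rfl⟩

/-- `Δ(p) = ∑ η ⊗ τ`, the sum over all decompositions of `p` into an initial part `τ` and a final
part `η`; the counit is `1` on trivial paths and `0` on all other paths. -/
instance : CoalgebraStruct K (PathCoalgebra K V) where
  comul := lift fun _ _ p => ((splittings p).map fun s => of K s.2.2 ⊗ₜ[K] of K s.2.1).sum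
  counit := lift fun _ _ p => if p.length = 0 then 1 else 0

theorem comul_of {a b : V} (p : Quiver.Path a b) : Coalgebra.comul (R := K) (of K p) =
    ((splittings p).map fun s => of K s.2.2 ⊗ₜ[K] of K s.2.1).sum := lift_of _ p

theorem counit_of {a b : V} (p : Quiver.Path a b) :
    Coalgebra.counit (R := K) (of K p) = if p.length = 0 then 1 else 0 := lift_of _ p

theorem sum_splittings_assoc {M : Type*} [AddCommMonoid M] {a b : V} (p : Quiver.Path a b)
    (F : ∀ c d : V, Quiver.Path a c → Quiver.Path c d → Quiver.Path d b → M) :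
    ((splittings p).map fun s =>
      ((splittings s.2.2).map fun r => F s.1 r.1 s.2.1 r.2.1 r.2.2).sum).sum =
    ((splittings p).map fun s =>
      ((splittings s.2.1).map fun r => F r.1 s.1 r.2.1 r.2.2 s.2.2).sum).sum := by
  induction p with
  | nil => simp [splittings]
  | cons p α ih =>
    have := ih fun c d x y z => F c d x y (.cons z α)
    simp only [splittings, List.map_cons, List.sum_cons, List.map_map, Function.comp_def,
      List.sum_map_add, List.map_nil, List.sum_nil, add_zero] at this ⊢
    rw [this, add_assoc]

theorem sum_splittings_counit {M : Type*} [AddCommMonoid M] {a b : V} (p : Quiver.Path a b)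
    (F : ∀ c : V, Quiver.Path a c → Quiver.Path c b → M) :
    ((splittings p).map fun s => if s.2.1.length = 0 then F s.1 s.2.1 s.2.2 else 0).sum =
      F a .nil p := by
  induction p with
  | nil => simp [splittings]
  | cons p α ih =>
    simpa [splittings, Function.comp_def] using ih fun c x y => F c x (.cons y α)

theorem tmul_list_sum {ι M N : Type*} [AddCommGroup M] [Module K M] [AddCommGroup N] [Module K N]
    (x : M) (l : List ι) (f : ι → N) :
    x ⊗ₜ[K] (l.map f).sum = (l.map fun i => x ⊗ₜ[K] f i).sum := by
  induction l with
  | nil => simp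
  | cons i l ih => simp [TensorProduct.tmul_add, ih]

theorem list_sum_tmul {ι M N : Type*} [AddCommGroup M] [Module K M] [AddCommGroup N] [Module K N]
    (x : N) (l : List ι) (f : ι → M) :
    (l.map f).sum ⊗ₜ[K] x = (l.map fun i => f i ⊗ₜ[K] x).sum := by
  induction l with
  | nil => simp
  | cons i l ih => simp [TensorProduct.add_tmul, ih]

/-- The path coalgebra. -/
instance : Coalgebra K (PathCoalgebra K V) where
  coassoc := linearMap_ext fun a b p => by
    have h := sum_splittings_assoc p
      fun c d x y z => of K z ⊗ₜ[K] (of K y ⊗ₜ[K] of K x)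
    simp only [LinearMap.comp_apply, comul_of, map_list_sum, List.map_map, Function.comp_def,
      LinearMap.rTensor_tmul, LinearMap.lTensor_tmul, LinearEquiv.coe_coe]
    refine Eq.trans (congrArg List.sum (List.map_congr_left fun s _ => ?_))
      (h.trans (congrArg List.sum (List.map_congr_left fun s _ => ?_)))
    · rw [list_sum_tmul, map_list_sum, List.map_map]
      rfl
    · rw [tmul_list_sum]
  rTensor_counit_comp_comul := linearMap_ext fun a b p => by
    cases p with
    | nil => simp [comul_of, counit_of, splittings]
    | cons p α => simp [comul_of, counit_of, splittings, Function.comp_def, map_list_sum]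
  lTensor_counit_comp_comul := linearMap_ext fun a b p => by
    have h := sum_splittings_counit p fun c x y => of K y ⊗ₜ[K] (1 : K)
    rw [LinearMap.comp_apply, comul_of, map_list_sum, List.map_map]
    refine Eq.trans ?_ h
    congr 1
    refine List.map_congr_left fun s _ => ?_
    simp only [Function.comp_apply, LinearMap.lTensor_tmul, counit_of]
    split_ifs <;> simp

open Classical in
/-- The functional on `KQ` that is `1` on the trivial paths at vertices in `X` and `0` on all
other paths. -/
def vertexFn (K : Type u) [Field K] {V : Type v} [Quiver.{w} V] (X : Set V) :
    PathCoalgebra K V →ₗ[K] K :=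
  lift fun a _ p => if p.length = 0 ∧ a ∈ X then 1 else 0

theorem vertexFn_of (X : Set V) {a b : V} (p : Quiver.Path a b) [Decidable (a ∈ X)] :
    vertexFn K X (of K p) = if p.length = 0 ∧ a ∈ X then 1 else 0 := by
  rw [vertexFn, lift_of]
  congr

theorem vertexFn_idem (X : Set V) : LinearMap.mul' K K ∘ₗ
    TensorProduct.map (vertexFn K X) (vertexFn K X) ∘ₗ Coalgebra.comul = vertexFn K X :=
  linearMap_ext fun a b p => by
    classical
    cases p with
    | nil => simp [comul_of, vertexFn_of, splittings]
    | cons p α => simp [comul_of, vertexFn_of, splittings, Function.comp_def, map_list_sum]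

/-- The idempotent `e_X` of the dual algebra of a subcoalgebra `C` of `KQ`. -/
def vertexIdempotent (C : Subcoalgebra K (PathCoalgebra K V)) (X : Set V) :
    DualIdempotent K C.toSubmodule where
  fn := vertexFn K X ∘ₗ C.toSubmodule.subtype
  idem := by
    refine congrArg WithConv.toConv ?_
    change LinearMap.mul' K K ∘ₗ TensorProduct.map (vertexFn K X ∘ₗ C.toSubmodule.subtype)
      (vertexFn K X ∘ₗ C.toSubmodule.subtype) ∘ₗ Coalgebra.comul = _
    rw [TensorProduct.map_comp, LinearMap.comp_assoc, C.map_subtype_comul]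
    exact congrArg (· ∘ₗ C.toSubmodule.subtype) (vertexFn_idem X)

/-- A subcoalgebra of `KQ` is admissible if it contains all vertices and all arrows. -/
def IsAdmissible (C : Subcoalgebra K (PathCoalgebra K V)) : Prop :=
  (∀ a : V, of K (Quiver.Path.nil : Quiver.Path a a) ∈ C.toSubmodule) ∧
    ∀ (a b : V) (α : a ⟶ b), of K α.toPath ∈ C.toSubmodule

/-- A nontrivial path `p` starting at `x` is an `x`-tail relative to `X` if `x` is its only vertex
in `X` and the path does not come back to `X` after the start. -/
def IsTail (X : Set V) {x y : V} (p : Quiver.Path x y) : Prop :=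
  0 < p.length ∧ {z | z ∈ p.vertices} ∩ X = {x} ∧ ∀ z ∈ p.vertices.tail, z ∉ X

/-- The subspace of `KQ` spanned by the `x`-tails relative to `X`. -/
def tailSpan (K : Type u) [Field K] {V : Type v} [Quiver.{w} V] (X : Set V) (x : V) :
    Submodule K (PathCoalgebra K V) :=
  Submodule.span K {c | ∃ (y : V) (p : Quiver.Path x y), IsTail X p ∧ c = of K p}

end PathCoalgebra

end

/-! ### Functionals on tensor factors -/

section Contraction

variable {K : Type*} [Field K] {V C : Type*} [AddCommGroup V] [Module K V] [AddCommGroup C]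
  [Module K C]

/-! Everything passes through the functor `M ↦ eM` from `C`-comodules to `eCe`-comodules
(`partFunctor`). It inverts the morphisms whose kernel and cokernel are killed by `e`, and the
functor `F` that it induces on the quotient category is fully faithful: a map `eM ⟶ eN` is
represented by the right fraction `M ⟵ G ⟶ N`, where `G` is the subcomodule of `M × N` generated by
its graph. Essential surjectivity of `F` is not needed.

(b) ⇒ (a). A left adjoint of `M ↦ eM`, composed with `F`, is a left adjoint of the quotient functor,
so it suffices to find a universal map `N ⟶ eM` for each `N`. Let `N` be finite-dimensional, and let
`N ⟶ eM` generate `M`. A functional on `M` is the same as a map `M ⟶ C`, and the induced map `N ⟶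
eC` determines it; hence `dim M ≤ dim Hom(N, eC)`. This is finite by quasifiniteness and induction
on `dim N`. A generated `M` of largest dimension is universal (`exists_isUniversal_of_finite`).
Since comodules are locally finite, universal maps for the finite-dimensional subcomodules of an
arbitrary `N` can be glued (`exists_isUniversal`).

(a) ⇒ (c). For `x ∈ X` let `N` be the line of the trivial path at `x`. The adjunction gives a map `u
: eN ⟶ eP` through which every map `eN ⟶ eM` factors. With `M = C`, each `w ∈ eC` with `ρ(w) = w ⊗
x` becomes the image of one fixed element `y` of `P` under a map `P ⟶ C`. All such images are
contractions of the single tensor `ρ(y)`, so these `w` fill only a finite-dimensional space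
(`finite_eigenspace_of_isColocalizing`).

The link with tails is that the solutions of `ρ(w) = w ⊗ x` in `eC` are, up to the trivial path at
`x`, exactly the combinations of `x`-tails lying in `C`: a cut of a path at a vertex of `X` gives a
term of `ρ`, and a tail has no such cut except at its start (`finite_eigenspace_iff`).

(c) ⇒ (b). Every nonzero `eCe`-comodule contains some `s ≠ 0` with `ρ(s) = s ⊗ x` for a vertex `x ∈
X` (`exists_eigenvector`). For a simple `S`, evaluation at `s` embeds `Hom(S, eC)` into the
eigenspace just described. -/

theorem TensorProduct.eq_zero_of_forall_rid_lTensor (z : V ⊗[K] C)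
    (h : ∀ f : C →ₗ[K] K, TensorProduct.rid K V (f.lTensor V z) = 0) : z = 0 := by
  classical
  let b := Module.Basis.ofVectorSpace K C
  -- In a basis of `C`, the coordinates of `z` are its contractions with the coordinate functionals.
  refine (TensorProduct.equivFinsuppOfBasisRight (M := V) b).injective ?_
  rw [map_zero]
  ext i
  rw [Finsupp.zero_apply, ← h (b.coord i)]
  clear h
  induction z with
  | zero => simp
  | tmul x y => simp
  | add x y hx hy => simp only [map_add, Finsupp.add_apply, hx, hy]

theorem TensorProduct.ext_rid_lTensor {z z' : V ⊗[K] C}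
    (h : ∀ f : C →ₗ[K] K, TensorProduct.rid K V (f.lTensor V z) =
      TensorProduct.rid K V (f.lTensor V z')) : z = z' :=
  sub_eq_zero.1 (eq_zero_of_forall_rid_lTensor _ fun f => by rw [map_sub, map_sub, h, sub_self])

theorem TensorProduct.exists_finite_rid_lTensor_mem (z : V ⊗[K] C) :
    ∃ U : Submodule K V, Module.Finite K U ∧
      ∀ f : C →ₗ[K] K, TensorProduct.rid K V (f.lTensor V z) ∈ U := by
  induction z with
  | zero => exact ⟨⊥, inferInstance, fun f => by simp⟩
  | tmul x y =>
    refine ⟨Submodule.span K {x}, inferInstance, fun f => ?_⟩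
    simpa using Submodule.smul_mem _ _ (Submodule.mem_span_singleton_self x)
  | add x y hx hy =>
    obtain ⟨U, _, hU⟩ := hx
    obtain ⟨U', _, hU'⟩ := hy
    refine ⟨U ⊔ U', inferInstance, fun f => ?_⟩
    rw [map_add, map_add]
    exact Submodule.add_mem_sup (hU f) (hU' f)

/-- Applied to `z = ρ(y)`, this bounds the images of one element `y` under all homomorphisms to the
regular comodule at once. -/
theorem TensorProduct.exists_finite_lid_rTensor_mem (z : V ⊗[K] C) :
    ∃ U : Submodule K C, Module.Finite K U ∧
      ∀ f : V →ₗ[K] K, TensorProduct.lid K C (f.rTensor C z) ∈ U := by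
  induction z with
  | zero => exact ⟨⊥, inferInstance, fun f => by simp⟩
  | tmul x y =>
    refine ⟨Submodule.span K {y}, inferInstance, fun f => ?_⟩
    simpa using Submodule.smul_mem _ _ (Submodule.mem_span_singleton_self y)
  | add x y hx hy =>
    obtain ⟨U, _, hU⟩ := hx
    obtain ⟨U', _, hU'⟩ := hy
    refine ⟨U ⊔ U', inferInstance, fun f => ?_⟩
    rw [map_add, map_add]
    exact Submodule.add_mem_sup (hU f) (hU' f)

end Contraction

noncomputable section

namespace RightComodule

variable {K : Type u} [Field K] {C : Type t} [AddCommGroup C] [Module K C] [Coalgebra K C]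

/-! ### Comodules as modules over the dual algebra -/

theorem act_apply (M : RightComodule K C) (f : C →ₗ[K] K) (m : M) :
    M.act f m = TensorProduct.rid K M (f.lTensor M (M.coact m)) := rfl

theorem act_add (M : RightComodule K C) (f g : C →ₗ[K] K) (m : M) :
    M.act (f + g) m = M.act f m + M.act g m := by
  simp [act_apply, LinearMap.lTensor_add]

theorem act_smul (M : RightComodule K C) (a : K) (f : C →ₗ[K] K) (m : M) :
    M.act (a • f) m = a • M.act f m := by
  simp [act_apply, LinearMap.lTensor_smul]

@[simp] theorem act_zero (M : RightComodule K C) (m : M) :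
    M.act (0 : C →ₗ[K] K) m = 0 := by
  simp [act_apply]

@[simp] theorem act_counit (M : RightComodule K C) (m : M) :
    M.act Coalgebra.counit m = m := by
  have := LinearMap.congr_fun M.counit m
  simp only [LinearMap.comp_apply] at this
  rw [act_apply, this]
  simp

/-- The convolution product `(f ⋆ g)(c) = ∑ f(c₍₁₎) g(c₍₂₎)` of two functionals. -/
def conv (f g : C →ₗ[K] K) : C →ₗ[K] K :=
  f ∘ₗ (TensorProduct.rid K C).toLinearMap ∘ₗ g.lTensor C ∘ₗ Coalgebra.comul

theorem conv_apply (f g : C →ₗ[K] K) (c : C) :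
    conv f g c = LinearMap.mul' K K (TensorProduct.map f g (Coalgebra.comul c)) := by
  simp only [conv, LinearMap.comp_apply, LinearEquiv.coe_coe]
  induction (Coalgebra.comul (R := K) c) with
  | zero => simp
  | tmul x y => simp [mul_comm]
  | add x y hx hy => simp only [map_add, hx, hy]

/-- Coassociativity in dual form: right comodules are left modules over the convolution algebra. -/
theorem act_conv (M : RightComodule K C) (f g : C →ₗ[K] K) (m : M) :
    M.act (conv f g) m = M.act f (M.act g m) := by
  have h0 : ∀ (u : M ⊗[K] C) (b : C),
      TensorProduct.rid K M (f.lTensor M (((TensorProduct.rid K C).toLinearMap ∘ₗ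
        g.lTensor C).lTensor M (TensorProduct.assoc K M C C (u ⊗ₜ b)))) =
        g b • TensorProduct.rid K M (f.lTensor M u) := by
    intro u b
    induction u with
    | zero => simp
    | tmul x y => simp
    | add x y hx hy => simp only [TensorProduct.add_tmul, map_add, hx, hy, smul_add]
  have h : ∀ z : M ⊗[K] C, M.act f (TensorProduct.rid K M (g.lTensor M z)) =
      TensorProduct.rid K M (f.lTensor M (((TensorProduct.rid K C).toLinearMap ∘ₗ
        g.lTensor C).lTensor M (TensorProduct.assoc K M C C (M.coact.rTensor C z)))) := by
    intro z
    induction z with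
    | zero => simp
    | tmul x y => rw [LinearMap.rTensor_tmul, h0]; simp [RightComodule.act]
    | add x y hx hy => simp only [map_add, hx, hy]
  have h2 := h (M.coact m)
  have h3 := LinearMap.congr_fun M.coassoc m
  simp only [LinearMap.comp_apply, LinearEquiv.coe_coe] at h3
  rw [h3, ← LinearMap.lTensor_comp_apply, ← LinearMap.lTensor_comp_apply] at h2
  exact h2.symm

/-- The image of `ρ(m)` in `(M ⧸ S) ⊗ C` is annihilated by every functional on `C`, hence is zero;
exactness of the tensor product then puts `ρ(m)` into `S ⊗ C`. Subcomodules can thus be recognised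
by the action alone. -/
theorem isSubcomodule_of_act {M : RightComodule K C} {S : Submodule K M}
    (h : ∀ (f : C →ₗ[K] K), ∀ m ∈ S, M.act f m ∈ S) : M.IsSubcomodule S := by
  intro m hm
  have hex := rTensor_exact C (LinearMap.exact_subtype_mkQ S) S.mkQ_surjective
  refine (hex (M.coact m)).1 (TensorProduct.eq_zero_of_forall_rid_lTensor _ fun f => ?_)
  have h' : ∀ z : M ⊗[K] C, TensorProduct.rid K (M ⧸ S) (f.lTensor _ (S.mkQ.rTensor C z)) =
      S.mkQ (TensorProduct.rid K M (f.lTensor M z)) := by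
    intro z
    induction z with
    | zero => simp
    | tmul x y => simp
    | add x y hx hy => simp only [map_add, hx, hy]
  rw [h']
  exact (Submodule.Quotient.mk_eq_zero _).2 (h f m hm)

theorem act_subι {M : RightComodule K C} {S : Submodule K M} (hS : M.IsSubcomodule S)
    (f : C →ₗ[K] K) (m : S) : S.subtype ((M.sub S hS).act f m) = M.act f (S.subtype m) :=
  (act_lin (M.subι S hS) f m).symm

theorem IsSubcomodule.act_mem {M : RightComodule K C} {S : Submodule K M}
    (hS : M.IsSubcomodule S) (f : C →ₗ[K] K) {m : M} (hm : m ∈ S) : M.act f m ∈ S := by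
  rw [show m = S.subtype ⟨m, hm⟩ from rfl, ← act_subι hS f]
  exact Subtype.prop _

/-- A linear map commuting with the action of all functionals is a homomorphism. -/
def homOfAct {M N : RightComodule K C} (g : M →ₗ[K] N)
    (h : ∀ (f : C →ₗ[K] K) (m : M), N.act f (g m) = g (M.act f m)) : M ⟶ N :=
  ⟨g, LinearMap.ext fun m => TensorProduct.ext_rid_lTensor fun f => by
    have h' : ∀ z : M ⊗[K] C, TensorProduct.rid K N (f.lTensor N (g.rTensor C z)) =
        g (TensorProduct.rid K M (f.lTensor M z)) := by
      intro z
      induction z with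
      | zero => simp
      | tmul x y => simp
      | add x y hx hy => simp only [map_add, hx, hy]
    exact (h f m).trans (h' _).symm⟩

/-! ### Generated subcomodules and local finiteness -/

/-- The action of the dual space on an element of a comodule. -/
def orbitMap (M : RightComodule K C) (m : M) : (C →ₗ[K] K) →ₗ[K] M where
  toFun f := M.act f m
  map_add' f g := M.act_add f g m
  map_smul' a f := M.act_smul a f m

/-- The subcomodule generated by an element. -/
def orbit (M : RightComodule K C) (m : M) : Submodule K M := LinearMap.range (M.orbitMap m)

theorem isSubcomodule_orbit (M : RightComodule K C) (m : M) : M.IsSubcomodule (M.orbit m) :=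
  isSubcomodule_of_act fun f _ ⟨g, hg⟩ => ⟨conv f g, (M.act_conv f g m).trans (by rw [← hg]; rfl)⟩

theorem mem_orbit (M : RightComodule K C) (m : M) : m ∈ M.orbit m :=
  ⟨Coalgebra.counit, M.act_counit m⟩

/-- The fundamental finiteness of comodules: `ρ(m)` is a finite sum of pure tensors, and the orbit
lies in the span of their left factors. -/
instance finite_orbit (M : RightComodule K C) (m : M) : Module.Finite K (M.orbit m) := by
  obtain ⟨U, _, hU⟩ := TensorProduct.exists_finite_rid_lTensor_mem (M.coact m)
  refine Submodule.finiteDimensional_of_le (S₂ := U) ?_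
  rintro _ ⟨f, rfl⟩
  exact hU f

/-- The subcomodule generated by a set of elements. -/
def gen (M : RightComodule K C) (s : Set M) : Submodule K M := ⨆ m ∈ s, M.orbit m

theorem isSubcomodule_iSup {M : RightComodule K C} {ι : Sort*} {S : ι → Submodule K M}
    (h : ∀ i, M.IsSubcomodule (S i)) : M.IsSubcomodule (⨆ i, S i) := by
  refine isSubcomodule_of_act fun f m hm => ?_
  induction hm using Submodule.iSup_induction' with
  | mem i x hx => exact Submodule.mem_iSup_of_mem i ((h i).act_mem f hx)
  | zero => simp
  | add x y _ _ hx hy => rw [map_add]; exact add_mem hx hy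

theorem isSubcomodule_gen (M : RightComodule K C) (s : Set M) : M.IsSubcomodule (M.gen s) :=
  isSubcomodule_iSup fun _ => isSubcomodule_iSup fun _ => M.isSubcomodule_orbit _

theorem act_mem_gen (M : RightComodule K C) {s : Set M} {m : M} (hm : m ∈ s) (f : C →ₗ[K] K) :
    M.act f m ∈ M.gen s :=
  Submodule.mem_iSup_of_mem m (Submodule.mem_iSup_of_mem hm ⟨f, rfl⟩)

theorem subset_gen (M : RightComodule K C) (s : Set M) : s ⊆ M.gen s := fun m hm => by
  have := M.act_mem_gen hm Coalgebra.counit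
  rwa [act_counit] at this

theorem gen_le (M : RightComodule K C) {s : Set M} {S : Submodule K M}
    (h : ∀ m ∈ s, ∀ f : C →ₗ[K] K, M.act f m ∈ S) : M.gen s ≤ S :=
  iSup₂_le fun m hm => by
    rintro _ ⟨f, rfl⟩
    exact h m hm f

theorem hom_ext_of_gen {M N : RightComodule K C} {s : Set M} (hs : M.gen s = ⊤) {f g : M ⟶ N}
    (h : ∀ m ∈ s, f.lin m = g.lin m) : f = g := by
  have : M.gen s ≤ LinearMap.eqLocus f.lin g.lin := M.gen_le fun m hm a => by
    rw [LinearMap.mem_eqLocus, ← act_lin, ← act_lin, h m hm]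
  rw [hs] at this
  exact hom_ext (LinearMap.ext fun x => this trivial)

theorem isIso_of_bijective {M N : RightComodule K C} (f : M ⟶ N)
    (hf : Function.Bijective f.lin) : IsIso f :=
  haveI := mono_of_injective f hf.1
  haveI := epi_of_surjective f hf.2
  isIso_of_mono_of_epi f

/-! ### The regular comodule and its cofreeness -/

variable (K C) in
/-- The coalgebra as a comodule over itself. -/
def regular : RightComodule K C where
  carrier := C
  coact := Coalgebra.comul
  coassoc := Coalgebra.coassoc
  counit := Coalgebra.lTensor_counit_comp_comul

/-- The homomorphism `m ↦ ∑ l(m₍₀₎) m₍₁₎` to the regular comodule. -/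
def toRegular (M : RightComodule K C) (l : M →ₗ[K] K) : M ⟶ regular K C :=
  ⟨(TensorProduct.lid K C).toLinearMap ∘ₗ l.rTensor C ∘ₗ M.coact, by
    have h0 : ∀ z : M ⊗[K] C, Coalgebra.comul (R := K)
        (TensorProduct.lid K C (l.rTensor C z)) =
        TensorProduct.lid K _ (l.rTensor _ (Coalgebra.comul.lTensor M z)) := by
      intro z
      induction z with
      | zero => simp
      | tmul x y => simp
      | add x y hx hy => simp only [map_add, hx, hy]
    have h1 : ∀ (u : M ⊗[K] C) (c : C), TensorProduct.lid K (C ⊗[K] C) (l.rTensor (C ⊗[K] C)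
        (TensorProduct.assoc K M C C (u ⊗ₜ c))) = TensorProduct.lid K C (l.rTensor C u) ⊗ₜ c := by
      intro u c
      induction u with
      | zero => simp
      | tmul x y => simp [TensorProduct.smul_tmul']
      | add x y hx hy => simp only [map_add, TensorProduct.add_tmul, hx, hy]
    have h2 : ∀ z : M ⊗[K] C, TensorProduct.lid K (C ⊗[K] C) (l.rTensor (C ⊗[K] C)
        (TensorProduct.assoc K M C C (M.coact.rTensor C z))) =
        ((TensorProduct.lid K C).toLinearMap ∘ₗ l.rTensor C ∘ₗ M.coact).rTensor C z := by
      intro z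
      induction z with
      | zero => simp
      | tmul x y => rw [LinearMap.rTensor_tmul, h1]; rfl
      | add x y hx hy => simp only [map_add, hx, hy]
    ext m
    have h3 := LinearMap.congr_fun M.coassoc m
    simp only [LinearMap.comp_apply, LinearEquiv.coe_coe] at h3
    exact (h0 _).trans ((congrArg _ (congrArg _ h3.symm)).trans (h2 _))⟩

theorem toRegular_lin (M : RightComodule K C) (l : M →ₗ[K] K) (m : M) :
    (M.toRegular l).lin m = TensorProduct.lid K C (l.rTensor C (M.coact m)) := rfl

variable (K C) in
/-- The counit, as a functional on the regular comodule. -/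
def regularCounit : regular K C →ₗ[K] K := Coalgebra.counit (R := K) (A := C)

/-- Half of the bijection between functionals on `M` and homomorphisms from `M` to `C`: the
functional is recovered by composing with the counit. The other half is `lin_eq_lid_rTensor`. -/
theorem regularCounit_toRegular (M : RightComodule K C) (l : M →ₗ[K] K) (m : M) :
    regularCounit K C ((M.toRegular l).lin m) = l m := by
  have h : ∀ z : M ⊗[K] C, Coalgebra.counit (R := K) (TensorProduct.lid K C (l.rTensor C z)) =
      l (TensorProduct.rid K M ((Coalgebra.counit (R := K)).lTensor M z)) := by
    intro z
    induction z with
    | zero => simp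
    | tmul x y => simp [mul_comm]
    | add x y hx hy => simp only [map_add, hx, hy]
  exact (h _).trans (congrArg l (M.act_counit m))

end RightComodule


namespace DualIdempotent

variable {K : Type u} [Field K] {C : Type t} [AddCommGroup C] [Module K C] [Coalgebra K C]
  (e : DualIdempotent K C)

/-! ### The functor `M ↦ eM` from comodules over `C` to comodules over `eCe` -/

/-- Written out, `ρ(em) = ∑ m₍₀₎ ⊗ e m₍₁₎`. This is what makes `partCoact` compatible with the
projection `M → eM`, so that the comodule axioms for `eM` can be checked on `M`. -/
theorem coact_act (M : RightComodule K C) :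
    M.coact ∘ₗ M.act e.fn = e.leftMul.lTensor M ∘ₗ M.coact := by
  have h0 : ∀ (u : M ⊗[K] C) (b : C),
      ((TensorProduct.rid K C).toLinearMap ∘ₗ e.fn.lTensor C).lTensor M
        (TensorProduct.assoc K M C C (u ⊗ₜ b)) = e.fn b • u := by
    intro u b
    induction u with
    | zero => simp
    | tmul x y => simp
    | add x y hx hy => simp only [TensorProduct.add_tmul, map_add, hx, hy, smul_add]
  have h : ∀ z : M ⊗[K] C, M.coact (TensorProduct.rid K M (e.fn.lTensor M z)) =
      ((TensorProduct.rid K C).toLinearMap ∘ₗ e.fn.lTensor C).lTensor M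
        (TensorProduct.assoc K M C C (M.coact.rTensor C z)) := by
    intro z
    induction z with
    | zero => simp
    | tmul x y => rw [LinearMap.rTensor_tmul, h0]; simp
    | add x y hx hy => simp only [map_add, hx, hy]
  ext m
  have h2 := h (M.coact m)
  have h3 := LinearMap.congr_fun M.coassoc m
  simp only [LinearMap.comp_apply, LinearEquiv.coe_coe] at h3
  rw [h3, ← LinearMap.lTensor_comp_apply] at h2
  exact h2

/-- `m ↦ e m`, as a map onto `eM`. -/
def toPart (M : RightComodule K C) : M →ₗ[K] LinearMap.range (M.act e.fn) :=
  (M.act e.fn).rangeRestrict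

theorem toPart_surjective (M : RightComodule K C) : Function.Surjective (e.toPart M) :=
  LinearMap.surjective_rangeRestrict _

theorem toPart_act (M : RightComodule K C) : e.toPart M ∘ₗ M.act e.fn = e.toPart M :=
  LinearMap.ext fun m => Subtype.ext (e.act_act M m)

/-- The structure map `ρ(m) = ∑ e m₍₀₎ ⊗ e m₍₁₎ e` of `eM`. -/
def partCoact (M : RightComodule K C) : LinearMap.range (M.act e.fn) →ₗ[K]
    LinearMap.range (M.act e.fn) ⊗[K] e.corner :=
  TensorProduct.map (e.toPart M) e.toCorner ∘ₗ M.coact ∘ₗ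
    (LinearMap.range (M.act e.fn)).subtype

theorem partCoact_toPart (M : RightComodule K C) : e.partCoact M ∘ₗ e.toPart M =
    TensorProduct.map (e.toPart M) e.toCorner ∘ₗ M.coact := by
  have h : (LinearMap.range (M.act e.fn)).subtype ∘ₗ e.toPart M = M.act e.fn := rfl
  rw [partCoact, LinearMap.comp_assoc, LinearMap.comp_assoc, h, coact_act,
    ← LinearMap.comp_assoc, LinearMap.map_comp_lTensor, toCorner_leftMul]

/-- The right `eCe`-comodule `eM`. -/
def part (M : RightComodule K C) : RightComodule K e.corner where
  carrier := LinearMap.range (M.act e.fn)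
  coact := e.partCoact M
  coassoc := by
    refine (LinearMap.cancel_right (e.toPart_surjective M)).1 ?_
    have h : (TensorProduct.assoc K (LinearMap.range (M.act e.fn)) e.corner e.corner).toLinearMap ∘ₗ
        TensorProduct.map (TensorProduct.map (e.toPart M) e.toCorner) e.toCorner =
        TensorProduct.map (e.toPart M) (TensorProduct.map e.toCorner e.toCorner) ∘ₗ
          (TensorProduct.assoc K M C C).toLinearMap := by
      ext; simp
    rw [LinearMap.comp_assoc, LinearMap.comp_assoc, partCoact_toPart, LinearMap.comp_assoc,
      partCoact_toPart, ← LinearMap.comp_assoc M.coact,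
      ← LinearMap.comp_assoc M.coact (TensorProduct.map (e.toPart M) e.toCorner)
        (Coalgebra.comul.lTensor _), LinearMap.rTensor_comp_map,
      LinearMap.lTensor_comp_map, partCoact_toPart, corner_comul_toCorner,
      ← LinearMap.map_comp_rTensor, ← LinearMap.map_comp_lTensor, LinearMap.comp_assoc,
      LinearMap.comp_assoc, ← LinearMap.comp_assoc _ (TensorProduct.map _ _), h,
      LinearMap.comp_assoc, M.coassoc]
  counit := by
    refine (LinearMap.cancel_right (e.toPart_surjective M)).1 ?_
    rw [LinearMap.comp_assoc, partCoact_toPart, ← LinearMap.comp_assoc,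
      LinearMap.lTensor_comp_map, corner_counit_toCorner]
    ext c
    have h : ∀ z : M ⊗[K] C, TensorProduct.map (e.toPart M) e.fn z =
        e.toPart M (TensorProduct.rid K M (e.fn.lTensor M z)) ⊗ₜ 1 := by
      intro z
      induction z with
      | zero => simp
      | tmul x y => simp [TensorProduct.smul_tmul]
      | add x y hx hy => simp only [map_add, hx, hy, TensorProduct.add_tmul]
    exact (h _).trans (congrArg (· ⊗ₜ[K] (1 : K)) (LinearMap.congr_fun (e.toPart_act M) c))

/-- The inclusion of `eM` into `M`. -/
def partι (M : RightComodule K C) : e.part M →ₗ[K] M := (LinearMap.range (M.act e.fn)).subtype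

/-- The projection of `M` onto `eM`. -/
def partπ (M : RightComodule K C) : M →ₗ[K] e.part M := e.toPart M

theorem partι_injective (M : RightComodule K C) : Function.Injective (e.partι M) :=
  Subtype.val_injective

theorem partι_partπ (M : RightComodule K C) (m : M) : e.partι M (e.partπ M m) = M.act e.fn m := rfl

theorem partπ_partι (M : RightComodule K C) (m : e.part M) : e.partπ M (e.partι M m) = m := by
  obtain ⟨_, n, rfl⟩ := m
  exact Subtype.ext (e.act_act M n)

theorem act_partι (M : RightComodule K C) (m : e.part M) :
    M.act e.fn (e.partι M m) = e.partι M m := by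
  rw [← partι_partπ, partπ_partι]

theorem part_act_partπ (M : RightComodule K C) (h : e.corner →ₗ[K] K) (m : M) :
    (e.part M).act h (e.partπ M m) = e.partπ M (M.act (h ∘ₗ e.toCorner) m) := by
  have h1 : ∀ z : M ⊗[K] C, TensorProduct.rid K _ (h.lTensor _
      (TensorProduct.map (e.toPart M) e.toCorner z)) =
      e.toPart M (TensorProduct.rid K M ((h ∘ₗ e.toCorner).lTensor M z)) := by
    intro z
    induction z with
    | zero => simp
    | tmul x y => simp
    | add x y hx hy => simp only [map_add, hx, hy]
  exact (congrArg _ (congrArg _ (LinearMap.congr_fun (e.partCoact_toPart M) m))).trans (h1 _)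

theorem partι_part_act (M : RightComodule K C) (h : e.corner →ₗ[K] K) (m : e.part M) :
    e.partι M ((e.part M).act h m) = M.act e.fn (M.act (h ∘ₗ e.toCorner) (e.partι M m)) := by
  conv_lhs => rw [← e.partπ_partι M m]
  rw [part_act_partπ, partι_partπ]

theorem conv_fn_left (f : C →ₗ[K] K) : RightComodule.conv e.fn f = f ∘ₗ e.rightMul := by
  ext c
  rw [RightComodule.conv_apply, rightMul, LinearMap.comp_apply, LinearMap.comp_apply,
    LinearMap.comp_apply, LinearEquiv.coe_coe]
  induction (Coalgebra.comul (R := K) c) with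
  | zero => simp
  | tmul x y => simp
  | add x y hx hy => simp only [map_add, hx, hy]

theorem conv_fn_right (f : C →ₗ[K] K) : RightComodule.conv f e.fn = f ∘ₗ e.leftMul := rfl

/-- A functional on `C`, restricted to `eCe` and pulled back along `c ↦ ece`, becomes the
convolution product `e f e`; on `eM` the right-hand `e` acts as the identity. -/
theorem act_act_restrict (M : RightComodule K C) (f : C →ₗ[K] K) (m : e.part M) :
    e.partι M ((e.part M).act (f ∘ₗ e.corner.subtype) m) =
      M.act e.fn (M.act f (e.partι M m)) := by
  have h : (f ∘ₗ e.corner.subtype) ∘ₗ e.toCorner =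
      RightComodule.conv (RightComodule.conv e.fn f) e.fn := by
    rw [conv_fn_right, conv_fn_left]; rfl
  rw [partι_part_act, h, RightComodule.act_conv, RightComodule.act_conv, e.act_partι, e.act_act]

/-- The homomorphism `eM ⟶ eN` induced by a homomorphism `M ⟶ N`. -/
def partMap {M N : RightComodule K C} (f : M ⟶ N) : e.part M ⟶ e.part N :=
  RightComodule.homOfAct (e.partπ N ∘ₗ f.lin ∘ₗ e.partι M) fun h m => by
    apply e.partι_injective N
    simp only [LinearMap.comp_apply]
    rw [part_act_partπ, partι_partπ, partι_partπ, partι_part_act, RightComodule.act_lin,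
      RightComodule.act_lin, RightComodule.act_lin, e.act_act]

theorem partι_partMap {M N : RightComodule K C} (f : M ⟶ N) (m : e.part M) :
    e.partι N ((e.partMap f).lin m) = f.lin (e.partι M m) := by
  change e.partι N (e.partπ N (f.lin (e.partι M m))) = _
  rw [partι_partπ, RightComodule.act_lin, act_partι]

/-- The functor `M ↦ eM` from `C`-comodules to `eCe`-comodules. -/
def partFunctor : RightComodule K C ⥤ RightComodule K e.corner where
  obj := e.part
  map := e.partMap
  map_id M := by
    exact RightComodule.hom_ext (LinearMap.ext fun m => e.partι_injective M
      (e.partι_partMap (𝟙 M) m))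
  map_comp {M N P} f g := by
    refine RightComodule.hom_ext (LinearMap.ext fun m => e.partι_injective P ?_)
    rw [partι_partMap, RightComodule.comp_lin, RightComodule.comp_lin, LinearMap.comp_apply,
      LinearMap.comp_apply, partι_partMap, partι_partMap]

theorem part_ext {M : RightComodule K C} {N : RightComodule K e.corner} {f g : N ⟶ e.part M}
    (h : ∀ n, e.partι M (f.lin n) = e.partι M (g.lin n)) : f = g :=
  RightComodule.hom_ext (LinearMap.ext fun n => e.partι_injective M (h n))

theorem partMap_add {M N : RightComodule K C} (f g : M ⟶ N) :
    e.partMap (f + g) = e.partMap f + e.partMap g := e.part_ext fun n => by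
  rw [partι_partMap, RightComodule.add_lin, RightComodule.add_lin, LinearMap.add_apply,
    LinearMap.add_apply, map_add, partι_partMap, partι_partMap]

theorem partMap_comp {M N P : RightComodule K C} (f : M ⟶ N) (g : N ⟶ P) :
    e.partMap (f ≫ g) = e.partMap f ≫ e.partMap g := e.partFunctor.map_comp f g

theorem partMap_id (M : RightComodule K C) : e.partMap (𝟙 M) = 𝟙 _ := e.partFunctor.map_id M

instance : e.partFunctor.Additive where
  map_add := e.partMap_add _ _

/-! ### The quotient category is a full subcategory of the category of comodules over `eCe` -/

theorem localizingSubcategory_kernel_iff {M N : RightComodule K C} (f : M ⟶ N) :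
    e.localizingSubcategory (kernel f) ↔ ∀ m : M, f.lin m = 0 → M.act e.fn m = 0 := by
  constructor
  · intro h m hm
    let g := kernel.lift f _ (RightComodule.subι_ker_comp f)
    have hg : g ≫ kernel.ι f = _ := kernel.lift_ι f _ (RightComodule.subι_ker_comp f)
    have hm' : m = (kernel.ι f).lin (g.lin ⟨m, hm⟩) :=
      (LinearMap.congr_fun (congrArg RightComodule.Hom.lin hg) ⟨m, hm⟩).symm
    rw [hm', RightComodule.act_lin, h, map_zero]
  · intro h m
    apply RightComodule.injective_of_mono (kernel.ι f)
    rw [map_zero, ← RightComodule.act_lin]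
    exact h _ (LinearMap.congr_fun (congrArg RightComodule.Hom.lin (kernel.condition f)) m)

theorem localizingSubcategory_cokernel_iff {M N : RightComodule K C} (f : M ⟶ N) :
    e.localizingSubcategory (cokernel f) ↔
      ∀ n : N, N.act e.fn n ∈ LinearMap.range f.lin := by
  constructor
  · intro h n
    let g := cokernel.desc f _ (RightComodule.comp_quotπ_range f)
    have hg : cokernel.π f ≫ g = _ := cokernel.π_desc f _ (RightComodule.comp_quotπ_range f)
    have : (LinearMap.range f.lin).mkQ (N.act e.fn n) = g.lin ((cokernel.π f).lin _) :=
      (LinearMap.congr_fun (congrArg RightComodule.Hom.lin hg) (N.act e.fn n)).symm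
    rw [← RightComodule.act_lin, h, map_zero] at this
    exact (Submodule.Quotient.mk_eq_zero _).1 this
  · intro h m
    obtain ⟨n, rfl⟩ := RightComodule.surjective_of_epi (cokernel.π f) m
    rw [RightComodule.act_lin]
    obtain ⟨k, hk⟩ := h n
    rw [← hk]
    exact LinearMap.congr_fun (congrArg RightComodule.Hom.lin (cokernel.condition f)) k

theorem isoModSerre_iff {M N : RightComodule K C} (f : M ⟶ N) :
    e.localizingSubcategory.isoModSerre f ↔ (∀ m : M, f.lin m = 0 → M.act e.fn m = 0) ∧
      ∀ n : N, N.act e.fn n ∈ LinearMap.range f.lin := by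
  rw [ObjectProperty.isoModSerre_iff, ObjectProperty.monoModSerre_iff,
    ObjectProperty.epiModSerre_iff, localizingSubcategory_kernel_iff,
    localizingSubcategory_cokernel_iff]

/-- Since `e` is the identity on `eM` and on `eN`, the two conditions of `isoModSerre_iff` turn into
injectivity and surjectivity of the induced map. -/
theorem isIso_partMap {M N : RightComodule K C} {f : M ⟶ N}
    (hf : e.localizingSubcategory.isoModSerre f) : IsIso (e.partMap f) := by
  rw [isoModSerre_iff] at hf
  refine RightComodule.isIso_of_bijective _ ⟨?_, fun n => ?_⟩
  · rw [← LinearMap.ker_eq_bot, eq_bot_iff]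
    intro m hm
    refine e.partι_injective M ?_
    rw [← act_partι, map_zero]
    refine hf.1 _ ?_
    rw [← partι_partMap, LinearMap.mem_ker.1 hm, map_zero]
  · obtain ⟨m, hm⟩ := hf.2 (e.partι N n)
    refine ⟨e.partπ M m, e.partι_injective N ?_⟩
    rw [partι_partMap, partι_partπ, ← RightComodule.act_lin, hm, act_partι, act_partι]

theorem isInvertedBy_partFunctor : e.localizingSubcategory.isoModSerre.IsInvertedBy
    e.partFunctor := fun _ _ _ hf => e.isIso_partMap hf

/-- The functor induced by `M ↦ eM` on the quotient category. -/
def quotientFunctor : e.localizingSubcategory.isoModSerre.Localization ⥤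
    RightComodule K e.corner :=
  Localization.lift e.partFunctor e.isInvertedBy_partFunctor e.localizingSubcategory.isoModSerre.Q

/-- The induced functor factors `M ↦ eM`. -/
def quotientFunctorFac :
    e.localizingSubcategory.isoModSerre.Q ⋙ e.quotientFunctor ≅ e.partFunctor :=
  Localization.fac _ _ _

/-- If `f` and `g` agree on `eM`, the kernel of `f - g` contains `eM`. Its inclusion into `M` is
then inverted in the quotient category, and it equalizes `f` and `g`. -/
theorem Q_map_eq_of_partMap_eq {M N : RightComodule K C} {f g : M ⟶ N}
    (h : e.partMap f = e.partMap g) : e.localizingSubcategory.isoModSerre.Q.map f =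
      e.localizingSubcategory.isoModSerre.Q.map g := by
  rw [MorphismProperty.map_eq_iff_precomp _ e.localizingSubcategory.isoModSerre]
  refine ⟨_, M.subι _ (RightComodule.isSubcomodule_ker (f - g)), ?_, ?_⟩
  · rw [isoModSerre_iff]
    refine ⟨fun m hm => ?_, fun m => ?_⟩
    · have hm' : m = 0 := Submodule.injective_subtype _ (hm.trans (map_zero _).symm)
      rw [hm', map_zero]
    · refine ⟨⟨M.act e.fn m, ?_⟩, rfl⟩
      rw [LinearMap.mem_ker, RightComodule.sub_lin, LinearMap.sub_apply, sub_eq_zero,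
        ← partι_partπ, ← partι_partMap, ← partι_partMap, h]
  · have := RightComodule.subι_ker_comp (f - g)
    rwa [Preadditive.comp_sub, sub_eq_zero] at this

instance : e.quotientFunctor.Faithful :=
  Functor.faithful_of_comp_of_hasLeftCalculusOfFractions
    e.localizingSubcategory.isoModSerre.Q e.localizingSubcategory.isoModSerre e.quotientFunctor
    fun _ _ f g h => e.Q_map_eq_of_partMap_eq (by
      have h' := congrArg (fun k => k ≫ e.quotientFunctorFac.hom.app _) h
      simp only [← Functor.comp_map, NatTrans.naturality] at h'
      exact (cancel_epi (e.quotientFunctorFac.app _).hom).1 h')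

/-- Fullness before localization. Take for `G` the subcomodule of `M × N` generated by the graph of
`g`. Passing to the generated subcomodule adds nothing after multiplication by `e`: `eG` is again
the graph, so the projection to `M` is an isomorphism modulo the subcategory. -/
theorem exists_rightFraction_part {M N : RightComodule K C} (g : e.part M ⟶ e.part N) :
    ∃ (G : RightComodule K C) (s : G ⟶ M) (f : G ⟶ N),
      e.localizingSubcategory.isoModSerre s ∧ e.partMap s ≫ g = e.partMap f := by
  let P := M.prod N
  let p : P ⟶ M := (M.prodBicone N).fst
  let q : P ⟶ N := (M.prodBicone N).snd
  let γ : e.part M → P := fun m => (e.partι M m, e.partι N (g.lin m))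
  let S := P.gen (Set.range γ)
  have hS : P.IsSubcomodule S := P.isSubcomodule_gen _
  -- For a generator, `e · a · γ(m) = γ(a' · m)` with `a'` the restriction of `a` to `eCe`, because
  -- `g` commutes with the action of `a'`.
  have hγ : ∀ z ∈ S, ∃ m, P.act e.fn z = γ m := by
    have : S ≤ (LinearMap.range ((e.partι M).prod (e.partι N ∘ₗ g.lin))).comap (P.act e.fn) := by
      refine P.gen_le ?_
      rintro _ ⟨m, rfl⟩ a
      refine ⟨(e.part M).act (a ∘ₗ e.corner.subtype) m, Prod.ext ?_ ?_⟩
      · change e.partι M _ = p.lin (P.act e.fn (P.act a (γ m)))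
        rw [← RightComodule.act_lin, ← RightComodule.act_lin, act_act_restrict]
        rfl
      · change e.partι N (g.lin _) = q.lin (P.act e.fn (P.act a (γ m)))
        rw [← RightComodule.act_lin, ← RightComodule.act_lin, ← RightComodule.act_lin,
          act_act_restrict]
        rfl
    intro z hz
    obtain ⟨m, hm⟩ := this hz
    exact ⟨m, hm.symm⟩
  let j : P.sub S hS ⟶ P := P.subι S hS
  have hj : Function.Injective j.lin := S.injective_subtype
  have hpj : ∀ z, (j ≫ p).lin z = p.lin (j.lin z) := fun _ => rfl
  have hγ0 : γ 0 = 0 := Prod.ext (map_zero _) ((congrArg _ (map_zero _)).trans (map_zero _))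
  refine ⟨P.sub S hS, j ≫ p, j ≫ q, ?_, ?_⟩
  · rw [isoModSerre_iff]
    refine ⟨fun z hz => ?_, fun m => ?_⟩
    · obtain ⟨m, hm⟩ := hγ (j.lin z) z.2
      apply hj
      have h0 : e.partι M m = 0 := by
        have : p.lin (γ m) = 0 := by
          rw [← hm, ← RightComodule.act_lin, ← hpj, hz, map_zero]
        exact this
      have h1 : m = 0 := e.partι_injective M (h0.trans (map_zero _).symm)
      rw [← RightComodule.act_lin, hm, h1, hγ0, map_zero]
    · exact ⟨⟨γ (e.partπ M m), P.subset_gen _ ⟨_, rfl⟩⟩, rfl⟩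
  · refine e.part_ext fun z => ?_
    obtain ⟨m, hm⟩ := hγ (j.lin (e.partι _ z)) (e.partι _ z).2
    rw [RightComodule.act_lin, act_partι] at hm
    have h1 : (e.partMap (j ≫ p)).lin z = m := by
      refine e.partι_injective M ?_
      rw [partι_partMap]
      exact congrArg p.lin hm
    rw [partι_partMap, RightComodule.comp_lin, LinearMap.comp_apply, h1]
    exact (congrArg q.lin hm).symm

instance : e.quotientFunctor.Full where
  map_surjective {X Y} g := by
    -- The localization has the same objects as the original category.
    obtain ⟨M, rfl⟩ : ∃ M, e.localizingSubcategory.isoModSerre.Q.obj M = X :=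
      ⟨_, (Localization.Construction.objEquiv _).apply_symm_apply X⟩
    obtain ⟨N, rfl⟩ : ∃ N, e.localizingSubcategory.isoModSerre.Q.obj N = Y :=
      ⟨_, (Localization.Construction.objEquiv _).apply_symm_apply Y⟩
    let Q := e.localizingSubcategory.isoModSerre.Q
    let i := e.quotientFunctorFac
    obtain ⟨G, s, f, hs, h⟩ :
        ∃ (G : RightComodule K C) (s : G ⟶ M) (f : G ⟶ N),
          e.localizingSubcategory.isoModSerre s ∧
          e.partFunctor.map s ≫ (i.inv.app M ≫ g ≫ i.hom.app N) = e.partFunctor.map f :=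
      e.exists_rightFraction_part _
    have : IsIso (Q.map s) := Localization.inverts Q e.localizingSubcategory.isoModSerre s hs
    refine ⟨inv (Q.map s) ≫ Q.map f, ?_⟩
    rw [Functor.map_comp, Functor.map_inv, IsIso.inv_comp_eq, ← cancel_mono (i.hom.app N)]
    have hf : e.quotientFunctor.map (Q.map f) ≫ i.hom.app N = i.hom.app G ≫ e.partFunctor.map f :=
      i.hom.naturality f
    have hs : e.quotientFunctor.map (Q.map s) ≫ i.hom.app M = i.hom.app G ≫ e.partFunctor.map s :=
      i.hom.naturality s
    rw [hf, ← h, ← reassoc_of% hs, Iso.hom_inv_id_app_assoc, Category.assoc]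

/-- With `L` left adjoint to `M ↦ eM` and `F` the fully faithful induced functor, `Hom(L F Y, M) ≅
Hom(F Y, eM) ≅ Hom(F Y, F Q M) ≅ Hom(Y, Q M)`. -/
theorem isColocalizing_of_isRightAdjoint (h : e.partFunctor.IsRightAdjoint) :
    IsColocalizing e.localizingSubcategory := by
  have adj := Adjunction.ofIsRightAdjoint e.partFunctor
  refine ⟨_, ⟨adj.restrictFullyFaithful (Functor.FullyFaithful.ofFullyFaithful e.quotientFunctor)
    (Functor.FullyFaithful.id _) (L := e.quotientFunctor ⋙ e.partFunctor.leftAdjoint)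
    (Functor.rightUnitor _).symm ((Functor.leftUnitor _).trans e.quotientFunctorFac.symm)⟩⟩

end DualIdempotent


namespace RightComodule

variable {K : Type u} [Field K] {C : Type t} [AddCommGroup C] [Module K C] [Coalgebra K C]

/-! ### Homomorphisms from a finite-dimensional comodule to a quasifinite one -/

theorem simple_of_subcomodule (M : RightComodule K C) [Nontrivial M]
    (h : ∀ S : Submodule K M, M.IsSubcomodule S → S ≠ ⊥ → S = ⊤) : Simple M where
  mono_isIso_iff_nonzero {N} f _ := by
    constructor
    · rintro _ rfl
      obtain ⟨m, hm⟩ := exists_ne (0 : M)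
      obtain ⟨n, hn⟩ := surjective_of_epi (0 : N ⟶ M) m
      exact hm (hn.symm.trans rfl)
    · intro hf
      refine isIso_of_bijective f ⟨injective_of_mono f, ?_⟩
      rw [← LinearMap.range_eq_top]
      refine h _ (isSubcomodule_range f) fun h0 => hf (hom_ext ?_)
      rwa [LinearMap.range_eq_bot] at h0

theorem IsSubcomodule.map_subtype {M : RightComodule K C} {S : Submodule K M}
    (hS : M.IsSubcomodule S) {T : Submodule K S} (hT : (M.sub S hS).IsSubcomodule T) :
    M.IsSubcomodule (T.map S.subtype) := by
  refine isSubcomodule_of_act ?_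
  rintro f _ ⟨m, hm, rfl⟩
  exact ⟨_, hT.act_mem f hm, act_subι hS f m⟩

theorem exists_simple_subcomodule (M : RightComodule K C) [Nontrivial M] [Module.Finite K M] :
    ∃ (S : Submodule K M) (hS : M.IsSubcomodule S), S ≠ ⊥ ∧ Simple (M.sub S hS) := by
  classical
  have hex : ∃ n, ∃ S : Submodule K M, M.IsSubcomodule S ∧ S ≠ ⊥ ∧ Module.finrank K S = n :=
    ⟨_, ⊤, isSubcomodule_of_act fun _ _ _ => trivial, top_ne_bot, rfl⟩
  -- A nonzero subcomodule of least dimension is simple.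
  obtain ⟨S, hS, h0, hn⟩ := Nat.find_spec hex
  have : Nontrivial (M.sub S hS) := Submodule.nontrivial_iff_ne_bot.2 h0
  refine ⟨S, hS, h0, simple_of_subcomodule _ fun (T : Submodule K S) hT hT0 => ?_⟩
  have hle : Module.finrank K S ≤ Module.finrank K (T.map S.subtype) := by
    rw [hn]
    refine Nat.find_min' hex ⟨_, hS.map_subtype hT, fun h => hT0 ?_, rfl⟩
    exact Submodule.map_injective_of_injective S.injective_subtype (h.trans (Submodule.map_bot _).symm)
  have hle' : Module.finrank K (T.map S.subtype) = Module.finrank K T :=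
    (Submodule.equivMapOfInjective _ S.injective_subtype T).finrank_eq.symm
  have : Module.Finite K (M.sub S hS) := inferInstanceAs (Module.Finite K S)
  refine Submodule.eq_top_of_finrank_eq (le_antisymm (Submodule.finrank_le T) ?_)
  exact hle.trans hle'.le

/-- This is left exactness of `Hom(-, N)` on `S → M → M ⧸ S`: a map that vanishes on `S` comes from
the quotient. -/
theorem finite_hom_of_sub_of_quot {M N : RightComodule K C} (S : Submodule K M)
    (hS : M.IsSubcomodule S) [Module.Finite K (M.sub S hS ⟶ N)]
    [Module.Finite K (M.quot S hS ⟶ N)] : Module.Finite K (M ⟶ N) := by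
  let r := Linear.leftComp K N (M.subι S hS)
  let q := Linear.leftComp K N (M.quotπ S hS)
  have hker : LinearMap.ker r ≤ LinearMap.range q := by
    intro f hf
    have hf' : M.subι S hS ≫ f = 0 := hf
    refine ⟨descSurj (M.quotπ S hS) S.mkQ_surjective f fun m hm => ?_,
      descSurj_fac _ S.mkQ_surjective _ _⟩
    have hm' : m ∈ S := (Submodule.Quotient.mk_eq_zero _).1 hm
    exact LinearMap.congr_fun (congrArg Hom.lin hf') ⟨m, hm'⟩
  have : Module.Finite K (LinearMap.ker r) := Submodule.finiteDimensional_of_le hker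
  have : Module.Finite K ((M ⟶ N) ⧸ LinearMap.ker r) :=
    Module.Finite.equiv r.quotKerEquivRange.symm
  exact Module.Finite.of_submodule_quotient (LinearMap.ker r)

/-- Induction on the dimension of `M`, splitting off a simple subcomodule. -/
theorem IsQuasifinite.finite_hom {N : RightComodule K C} (hN : N.IsQuasifinite)
    (M : RightComodule K C) [Module.Finite K M] : Module.Finite K (M ⟶ N) := by
  induction hn : Module.finrank K M using Nat.strong_induction_on generalizing M with
  | _ n ih =>
    cases subsingleton_or_nontrivial M with
    | inl h =>
      have : Subsingleton (M ⟶ N) := ⟨fun f g => hom_ext (LinearMap.ext fun m => by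
        rw [Subsingleton.elim m 0, map_zero, map_zero])⟩
      infer_instance
    | inr h =>
      obtain ⟨S, hS, h0, hsimple⟩ := M.exists_simple_subcomodule
      have h1 : Module.Finite K (M.sub S hS ⟶ N) := hN _ hsimple
      have : Module.Finite K (M.quot S hS) := inferInstanceAs (Module.Finite K (M ⧸ S))
      have hlt : Module.finrank K (M.quot S hS) < n := by
        have hpos := Submodule.one_le_finrank_iff.2 h0
        have hsum := Submodule.finrank_quotient_add_finrank S
        change Module.finrank K (M ⧸ S) < n
        lia
      have h2 := ih _ hlt (M.quot S hS) rfl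
      exact finite_hom_of_sub_of_quot S hS

/-! ### Direct sums -/

section DirectSum

variable {ι : Type t} [DecidableEq ι] (L : ι → RightComodule K C)

variable {L} in
theorem toModule_comp_lof {M : Type*} [AddCommGroup M] [Module K M] (f : ∀ i, L i →ₗ[K] M)
    (i : ι) : DirectSum.toModule K ι M f ∘ₗ DirectSum.lof K ι (fun i => L i) i = f i := by
  ext m
  rw [LinearMap.comp_apply]
  erw [DirectSum.toModule_lof]

/-- The structure map of a direct sum. -/
def directSumCoact : (DirectSum ι fun i => L i) →ₗ[K] (DirectSum ι fun i => L i) ⊗[K] C :=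
  DirectSum.toModule K ι _ fun i =>
    (DirectSum.lof K ι (fun i => L i) i).rTensor C ∘ₗ (L i).coact

theorem directSumCoact_lof (i : ι) : directSumCoact L ∘ₗ DirectSum.lof K ι (fun i => L i) i =
    (DirectSum.lof K ι (fun i => L i) i).rTensor C ∘ₗ (L i).coact :=
  toModule_comp_lof _ i

/-- The direct sum of a family of comodules. -/
def directSum : RightComodule K C where
  carrier := DirectSum ι fun i => L i
  coact := directSumCoact L
  coassoc := DirectSum.linearMap_ext K fun i => coassoc_comp (L i) _ _ (directSumCoact_lof L i)
  counit := DirectSum.linearMap_ext K fun i => counit_comp (L i) _ _ (directSumCoact_lof L i)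

/-- The inclusion of a summand. -/
def directSumι (i : ι) : L i ⟶ directSum L :=
  ⟨DirectSum.lof K ι (fun i => L i) i, directSumCoact_lof L i⟩

variable {L} in
theorem directSum_hom_ext {M : RightComodule K C} {f g : directSum L ⟶ M}
    (h : ∀ i, directSumι L i ≫ f = directSumι L i ≫ g) : f = g :=
  hom_ext (DirectSum.linearMap_ext K fun i => congrArg Hom.lin (h i))

variable {L} in
theorem coact_toModule {M : RightComodule K C} (f : ∀ i, L i ⟶ M) :
    M.coact ∘ₗ DirectSum.toModule K ι M (fun i => (f i).lin) =
      (DirectSum.toModule K ι M fun i => (f i).lin).rTensor C ∘ₗ directSumCoact L :=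
  DirectSum.linearMap_ext K fun i => by
    have h1 := toModule_comp_lof (fun i => (f i).lin) i
    rw [LinearMap.comp_assoc, LinearMap.comp_assoc, h1, (f i).comm, directSumCoact_lof,
      ← LinearMap.comp_assoc, ← LinearMap.rTensor_comp, h1]

variable {L} in
/-- The homomorphism from a direct sum given by a family of homomorphisms. -/
def directSumDesc {M : RightComodule K C} (f : ∀ i, L i ⟶ M) : directSum L ⟶ M :=
  ⟨DirectSum.toModule K ι M fun i => (f i).lin, coact_toModule f⟩

variable {L} in
theorem directSumι_desc {M : RightComodule K C} (f : ∀ i, L i ⟶ M) (i : ι) :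
    directSumι L i ≫ directSumDesc f = f i :=
  hom_ext (toModule_comp_lof (fun i => (f i).lin) i)

end DirectSum

/-! ### Gluing homomorphisms along finite-dimensional subcomodules -/

/-- An element of a subspace, as an element of the subcomodule. -/
def subMk {M : RightComodule K C} {S : Submodule K M} (hS : M.IsSubcomodule S) (m : M)
    (hm : m ∈ S) : M.sub S hS := ⟨m, hm⟩

theorem act_subMk {M : RightComodule K C} {S : Submodule K M} (hS : M.IsSubcomodule S) (m : M)
    (hm : m ∈ S) (f : C →ₗ[K] K) :
    (M.sub S hS).act f (subMk hS m hm) = subMk hS (M.act f m) (hS.act_mem f hm) :=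
  Subtype.ext (act_subι hS f ⟨m, hm⟩)

/-- A family of homomorphisms on all finite-dimensional subcomodules that agree on common elements
extends to the whole comodule. -/
theorem exists_hom_of_finite_sub {N M : RightComodule K C}
    (θ : ∀ (S : Submodule K N) (hS : N.IsSubcomodule S), Module.Finite K S → (N.sub S hS ⟶ M))
    (h : ∀ S hS fS T hT fT (n : N) (hnS : n ∈ S) (hnT : n ∈ T),
      (θ S hS fS).lin (subMk hS n hnS) = (θ T hT fT).lin (subMk hT n hnT)) :
    ∃ f : N ⟶ M, ∀ S hS fS, N.subι S hS ≫ f = θ S hS fS := by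
  -- The value at `n` is read off on the orbit of `n`. Additivity is tested on the sum of two
  -- orbits, which is a finite-dimensional subcomodule containing both elements.
  let F : N → M := fun n =>
    (θ _ (N.isSubcomodule_orbit n) (N.finite_orbit n)).lin (subMk _ n (N.mem_orbit n))
  have hF : ∀ S hS fS n (hn : n ∈ S), F n = (θ S hS fS).lin (subMk hS n hn) :=
    fun S hS fS n hn => h _ _ _ _ _ _ _ _ _
  have hsup : ∀ a b : N, N.IsSubcomodule (N.orbit a ⊔ N.orbit b) := fun a b => by
    rw [sup_eq_iSup]
    exact isSubcomodule_iSup fun i => by cases i <;> exact N.isSubcomodule_orbit _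
  have hact : ∀ (f : C →ₗ[K] K) (n : N), N.act f n ∈ N.orbit n := fun f n => ⟨f, rfl⟩
  refine ⟨homOfAct ⟨⟨F, fun a b => ?_⟩, fun c a => ?_⟩ fun f n => ?_, fun S hS fS =>
    hom_ext (LinearMap.ext fun n => hF S hS fS n.1 n.2)⟩
  · have ha := Submodule.mem_sup_left (T := N.orbit b) (N.mem_orbit a)
    have hb := Submodule.mem_sup_right (S := N.orbit a) (N.mem_orbit b)
    rw [hF _ (hsup a b) inferInstance a ha, hF _ (hsup a b) inferInstance b hb,
      hF _ (hsup a b) inferInstance (a + b) (add_mem ha hb), ← map_add]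
    rfl
  · have ha := N.mem_orbit a
    have hS := N.isSubcomodule_orbit a
    change F (c • a) = c • F a
    rw [hF _ hS inferInstance a ha, hF _ hS inferInstance _ (Submodule.smul_mem _ c ha),
      ← map_smul]
    rfl
  · have hS := N.isSubcomodule_orbit n
    change M.act f (F n) = F (N.act f n)
    rw [hF _ hS inferInstance n (N.mem_orbit n), hF _ hS inferInstance _ (hact f n), act_lin,
      act_subMk]

end RightComodule


namespace DualIdempotent

open RightComodule

variable {K : Type u} [Field K] {C : Type t} [AddCommGroup C] [Module K C] [Coalgebra K C]
  (e : DualIdempotent K C)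

/-! ### A left adjoint of `M ↦ eM` if `eC` is quasifinite -/

theorem partMap_smul {M N : RightComodule K C} (a : K) (f : M ⟶ N) :
    e.partMap (a • f) = a • e.partMap f := e.part_ext fun n => by
  rw [partι_partMap, smul_lin, smul_lin, LinearMap.smul_apply, LinearMap.smul_apply, map_smul,
    partι_partMap]

/-- A homomorphism `N ⟶ eM` generates `M` if `M` is the smallest subcomodule that contains its
values. -/
def Generates {N : RightComodule K e.corner} {M : RightComodule K C} (f : N ⟶ e.part M) : Prop :=
  M.gen (Set.range fun n => e.partι M (f.lin n)) = ⊤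

variable {e} in
-- This gives the uniqueness half of the universal property, so that only existence of
-- factorizations has to be arranged.
theorem Generates.hom_ext {N : RightComodule K e.corner} {M P : RightComodule K C}
    {f : N ⟶ e.part M} (hf : e.Generates f) {g h : M ⟶ P}
    (hgh : f ≫ e.partMap g = f ≫ e.partMap h) : g = h := by
  refine hom_ext_of_gen hf ?_
  rintro _ ⟨n, rfl⟩
  change g.lin (e.partι M (f.lin n)) = h.lin (e.partι M (f.lin n))
  rw [← partι_partMap, ← partι_partMap]
  exact congrArg (e.partι P) (LinearMap.congr_fun (congrArg Hom.lin hgh) n)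

/-- A homomorphism `N ⟶ eM` corestricts to one that generates a subcomodule of `M`. -/
theorem exists_generates {N : RightComodule K e.corner} {M : RightComodule K C}
    (f : N ⟶ e.part M) : ∃ (G : RightComodule K C) (j : G ⟶ M) (g : N ⟶ e.part G),
      Function.Injective j.lin ∧ g ≫ e.partMap j = f ∧ e.Generates g := by
  let s : Set M := Set.range fun n => e.partι M (f.lin n)
  have hS : M.IsSubcomodule (M.gen s) := M.isSubcomodule_gen s
  let j := M.subι _ hS
  have hj : Function.Injective j.lin := (M.gen s).injective_subtype
  have hj' : Function.Injective (e.partMap j).lin := fun a b hab => by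
    refine e.partι_injective _ (hj ?_)
    rw [← partι_partMap, ← partι_partMap, hab]
  have hmem : ∀ n, e.partι M (f.lin n) ∈ M.gen s := fun n => M.subset_gen s ⟨n, rfl⟩
  have hrange : ∀ n, f.lin n ∈ LinearMap.range (e.partMap j).lin := fun n => by
    refine ⟨e.partπ _ (subMk hS _ (hmem n)), e.partι_injective M ?_⟩
    rw [partι_partMap, partι_partπ, ← act_lin]
    exact e.act_partι M _
  have hfac := liftInj_fac (e.partMap j) hj' f hrange
  refine ⟨_, j, liftInj (e.partMap j) hj' f hrange, hj, hfac, ?_⟩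
  have hval : ∀ n, j.lin (e.partι _ ((liftInj (e.partMap j) hj' f hrange).lin n)) =
      e.partι M (f.lin n) := fun n => by
    rw [← partι_partMap]
    exact congrArg (e.partι M) (LinearMap.congr_fun (congrArg Hom.lin hfac) n)
  rw [Generates, eq_top_iff]
  rintro z -
  have hle : M.gen s ≤ ((M.sub _ hS).gen (Set.range fun n => e.partι _
      ((liftInj (e.partMap j) hj' f hrange).lin n))).map j.lin := by
    refine M.gen_le ?_
    rintro _ ⟨n, rfl⟩ a
    refine ⟨_, act_mem_gen _ (Set.mem_range_self n) a, ?_⟩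
    rw [← act_lin, hval]
  obtain ⟨z', hz', h⟩ := hle z.2
  rwa [hj h] at hz'

variable {e} in
/-- A comodule `M` generated by `f : N ⟶ eM` has dimension at most that of `Hom(N, eC)`: a
functional on `M` is determined by the homomorphism `N ⟶ eC` that it induces. -/
theorem Generates.finite {N : RightComodule K e.corner} {M : RightComodule K C}
    {f : N ⟶ e.part M} (hf : e.Generates f) [Module.Finite K (N ⟶ e.leftComodule)] :
    Module.Finite K M ∧ Module.finrank K M ≤ Module.finrank K (N ⟶ e.leftComodule) := by
  -- A functional `l` is sent to the composite `N ⟶ eM ⟶ eC` whose second map is induced by `m ↦ ∑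
  -- l(m₍₀₎) m₍₁₎`. As `f` generates `M`, the composite determines the map `M ⟶ C`, and the counit
  -- then returns `l`.
  let Φ : Module.Dual K M →ₗ[K] (N ⟶ e.part (regular K C)) :=
    { toFun := fun l => f ≫ e.partMap (M.toRegular l)
      map_add' := fun a b => by
        rw [← Preadditive.comp_add, ← partMap_add]
        congr 2
        ext m
        simp [toRegular_lin, LinearMap.rTensor_add]
        rfl
      map_smul' := fun a b => by
        rw [RingHom.id_apply, ← Linear.comp_smul, ← partMap_smul]
        congr 2
        ext m
        simp [toRegular_lin, LinearMap.rTensor_smul]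
        rfl }
  have hΦ : Function.Injective Φ := fun a b hab => by
    have h := hf.hom_ext hab
    ext m
    rw [← regularCounit_toRegular, h, regularCounit_toRegular]
  -- The comodule `eC` of the statement and the part of the regular comodule agree by definition.
  have hfin : Module.Finite K (N ⟶ e.part (regular K C)) := ‹_›
  have : Module.Finite K (Module.Dual K M) := Module.Finite.of_injective Φ hΦ
  have : Module.Finite K M := (Module.finite_dual_iff K).1 this
  refine ⟨this, ?_⟩
  rw [← Subspace.dual_finrank_eq]
  exact LinearMap.finrank_le_finrank_of_injective hΦ

/-- `f : N ⟶ eM` is universal among all homomorphisms from `N` to a comodule of the form `eP`. -/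
structure IsUniversal {N : RightComodule K e.corner} {M : RightComodule K C} (f : N ⟶ e.part M) :
    Prop where
  exists_fac : ∀ (P : RightComodule K C) (g : N ⟶ e.part P), ∃ h : M ⟶ P, f ≫ e.partMap h = g
  generates : e.Generates f

/-- The comodule of largest dimension among those generated by a homomorphism from `N` is
universal. -/
theorem exists_isUniversal_of_finite (N : RightComodule K e.corner)
    [Module.Finite K (N ⟶ e.leftComodule)] :
    ∃ (M : RightComodule K C) (f : N ⟶ e.part M), e.IsUniversal f := by
  classical
  let s : Set ℕ := {d | ∃ (M : RightComodule K C) (f : N ⟶ e.part M),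
    e.Generates f ∧ Module.finrank K M = d}
  have hs : s.Nonempty := by
    obtain ⟨G, j, g, -, -, hg⟩ := e.exists_generates (0 : N ⟶ e.part (regular K C))
    exact ⟨_, G, g, hg, rfl⟩
  have hb : BddAbove s := ⟨_, by
    rintro _ ⟨M, f, hf, rfl⟩
    exact hf.finite.2⟩
  obtain ⟨M, f, hf, hmax⟩ := Nat.sSup_mem hs hb
  refine ⟨M, f, fun P g => ?_, hf⟩
  let i₁ : M ⟶ M.prod P := (M.prodBicone P).inl
  let i₂ : P ⟶ M.prod P := (M.prodBicone P).inr
  let p : M.prod P ⟶ M := (M.prodBicone P).fst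
  let q : M.prod P ⟶ P := (M.prodBicone P).snd
  -- Here `G` is the subcomodule of `M × P` generated by the pair `(f, g)`. It projects onto `M`
  -- because `f` generates `M`, and by maximality it is not larger, so the projection is an
  -- isomorphism. Its inverse followed by the projection to `P` is the required factorization of
  -- `g`.
  obtain ⟨G, j, k, hj, hk, hgen⟩ := e.exists_generates (f ≫ e.partMap i₁ + g ≫ e.partMap i₂)
  have h11 : i₁ ≫ p = 𝟙 _ := (M.prodBicone P).inl_fst
  have h12 : i₁ ≫ q = 0 := (M.prodBicone P).inl_snd
  have h21 : i₂ ≫ p = 0 := (M.prodBicone P).inr_fst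
  have h22 : i₂ ≫ q = 𝟙 _ := (M.prodBicone P).inr_snd
  have h0 : ∀ A B : RightComodule K C, e.partMap (0 : A ⟶ B) = 0 := fun A B =>
    e.partFunctor.map_zero A B
  have hp : k ≫ e.partMap (j ≫ p) = f := by
    rw [partMap_comp, ← Category.assoc, hk, Preadditive.add_comp, Category.assoc, Category.assoc,
      ← partMap_comp, ← partMap_comp, h11, h21, h0, partMap_id, Category.comp_id, comp_zero,
      add_zero]
  have hq : k ≫ e.partMap (j ≫ q) = g := by
    rw [partMap_comp, ← Category.assoc, hk, Preadditive.add_comp, Category.assoc, Category.assoc,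
      ← partMap_comp, ← partMap_comp, h12, h22, h0, partMap_id, Category.comp_id, comp_zero,
      zero_add]
  have hsurj : Function.Surjective (j ≫ p).lin := by
    rw [← LinearMap.range_eq_top, eq_top_iff, ← hf]
    refine M.gen_le ?_
    rintro _ ⟨n, rfl⟩ a
    refine (isSubcomodule_range (j ≫ p)).act_mem a ⟨e.partι G (k.lin n), ?_⟩
    rw [← partι_partMap]
    exact congrArg (e.partι M) (LinearMap.congr_fun (congrArg Hom.lin hp) n)
  have hfinG := hgen.finite.1
  have hfinM := hf.finite.1
  have hrank : Module.finrank K G = Module.finrank K M :=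
    le_antisymm (by rw [hmax]; exact le_csSup hb ⟨G, k, hgen, rfl⟩)
      (LinearMap.finrank_le_finrank_of_surjective hsurj)
  have hinj : Function.Injective (j ≫ p).lin :=
    (LinearMap.injective_iff_surjective_of_finrank_eq_finrank hrank).2 hsurj
  have hiso : IsIso (j ≫ p) := isIso_of_bijective _ ⟨hinj, hsurj⟩
  refine ⟨inv (j ≫ p) ≫ j ≫ q, ?_⟩
  rw [partMap_comp, ← hq, ← hp, Category.assoc, ← Category.assoc (e.partMap (j ≫ p)),
    ← partMap_comp, IsIso.hom_inv_id, partMap_id, Category.id_comp]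

/-- Universal homomorphisms for the finite-dimensional subcomodules of `N` glue together to one
for `N`. -/
theorem exists_isUniversal (h : e.leftComodule.IsQuasifinite) (N : RightComodule K e.corner) :
    ∃ (M : RightComodule K C) (f : N ⟶ e.part M), e.IsUniversal f := by
  classical
  let ι := {S : Submodule K N // N.IsSubcomodule S ∧ Module.Finite K S}
  have hex : ∀ i : ι, ∃ (M : RightComodule K C) (f : N.sub i.1 i.2.1 ⟶ e.part M),
      e.IsUniversal f := fun i => by
    have : Module.Finite K (N.sub i.1 i.2.1) := i.2.2
    have := h.finite_hom (N.sub i.1 i.2.1)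
    exact e.exists_isUniversal_of_finite _
  choose L φ hφ using hex
  let a : ∀ i, L i ⟶ directSum L := directSumι L
  let γ : ∀ i : ι, N.sub i.1 i.2.1 → directSum L := fun i n => (a i).lin (e.partι _ ((φ i).lin n))
  -- The relations identify the two images of every common element of two finite-dimensional
  -- subcomodules, nested or not. This is exactly the compatibility that `exists_hom_of_finite_sub`
  -- asks for.
  let s : Set (directSum L) := {z | ∃ (i j : ι) (n : N) (hi : n ∈ i.1) (hj : n ∈ j.1),
    z = γ i (subMk i.2.1 n hi) - γ j (subMk j.2.1 n hj)}
  have hR := (directSum L).isSubcomodule_gen s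
  let π := (directSum L).quotπ _ hR
  have hπ : Function.Surjective π.lin := Submodule.mkQ_surjective _
  have hπs : ∀ z ∈ s, π.lin z = 0 := fun z hz =>
    (Submodule.Quotient.mk_eq_zero _).2 ((directSum L).subset_gen s hz)
  let M := (directSum L).quot _ hR
  let θ : ∀ i : ι, N.sub i.1 i.2.1 ⟶ e.part M := fun i => φ i ≫ e.partMap (a i ≫ π)
  have hθ : ∀ i n, e.partι M ((θ i).lin n) = π.lin (γ i n) := fun i n => e.partι_partMap _ _
  obtain ⟨f, hf⟩ := exists_hom_of_finite_sub (N := N) (M := e.part M)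
    (fun S hS fS => θ ⟨S, hS, fS⟩) (fun S hS fS T hT fT n hnS hnT => by
      refine e.partι_injective M ?_
      rw [hθ, hθ, ← sub_eq_zero, ← map_sub]
      exact hπs _ ⟨⟨S, hS, fS⟩, ⟨T, hT, fT⟩, n, hnS, hnT, rfl⟩)
  have hf' : ∀ i : ι, N.subι i.1 i.2.1 ≫ f = φ i ≫ e.partMap (a i ≫ π) :=
    fun i => hf i.1 i.2.1 i.2.2
  have hfn : ∀ (i : ι) n, e.partι M (f.lin ((N.subι i.1 i.2.1).lin n)) = π.lin (γ i n) :=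
    fun i n => by
      rw [← hθ]
      exact congrArg (e.partι M) (LinearMap.congr_fun (congrArg Hom.lin (hf' i)) n)
  have hNι : ∀ {P : RightComodule K e.corner} {g g' : N ⟶ P},
      (∀ i : ι, N.subι i.1 i.2.1 ≫ g = N.subι i.1 i.2.1 ≫ g') → g = g' := fun hg =>
    RightComodule.hom_ext (LinearMap.ext fun n => LinearMap.congr_fun (congrArg Hom.lin
      (hg ⟨N.orbit n, N.isSubcomodule_orbit n, inferInstance⟩)) ⟨n, N.mem_orbit n⟩)
  refine ⟨M, f, fun P g => ?_, ?_⟩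
  · choose b hb using fun i => (hφ i).exists_fac P (N.subι i.1 i.2.1 ≫ g)
    let d : directSum L ⟶ P := directSumDesc b
    have hd : ∀ i, a i ≫ d = b i := directSumι_desc b
    have hdγ : ∀ i n, d.lin (γ i n) = e.partι P (g.lin ((N.subι i.1 i.2.1).lin n)) :=
      fun i n => by
        have h1 : d.lin (γ i n) = (b i).lin (e.partι _ ((φ i).lin n)) :=
          LinearMap.congr_fun (congrArg Hom.lin (hd i)) _
        rw [h1, ← partι_partMap]
        exact congrArg (e.partι P) (LinearMap.congr_fun (congrArg Hom.lin (hb i)) n)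
    -- On the image of `n` in any summand, `d` takes the value `g(n)`, which does not depend on the
    -- summand; so `d` kills the relations.
    have hker : LinearMap.ker π.lin ≤ LinearMap.ker d.lin := by
      refine (Submodule.ker_mkQ _).le.trans ((directSum L).gen_le ?_)
      rintro _ ⟨i, j, n, hi, hj, rfl⟩ x
      rw [LinearMap.mem_ker, ← act_lin, map_sub, hdγ, hdγ]
      exact (congrArg (P.act x) (sub_self _)).trans (map_zero _)
    have hfac := descSurj_fac π hπ d hker
    refine ⟨descSurj π hπ d hker, hNι fun i => ?_⟩
    rw [← Category.assoc, hf', Category.assoc, ← partMap_comp, Category.assoc, hfac, hd, hb]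
  · have hmem : ∀ (i : ι) n, π.lin (γ i n) ∈
        M.gen (Set.range fun n => e.partι M (f.lin n)) := fun i n =>
      M.subset_gen _ ⟨_, hfn i n⟩
    have hgen := M.isSubcomodule_gen (Set.range fun n => e.partι M (f.lin n))
    -- The quotient of `M` by the generated subcomodule vanishes, since on each `L i` the composite
    -- map kills the generators coming from `φ i`.
    have hzero : M.quotπ _ hgen = 0 := by
      have := epi_of_surjective π hπ
      rw [← cancel_epi π, comp_zero]
      refine directSum_hom_ext fun i => ?_
      rw [comp_zero]
      refine hom_ext_of_gen (hφ i).generates ?_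
      rintro _ ⟨n, rfl⟩
      exact (Submodule.Quotient.mk_eq_zero _).2 (hmem i n)
    rw [Generates, eq_top_iff]
    intro z _
    exact (Submodule.Quotient.mk_eq_zero _).1
      (LinearMap.congr_fun (congrArg Hom.lin hzero) z)

/-- A universal map out of `N` is an initial object of the comma category under `N`. -/
theorem isRightAdjoint_partFunctor (h : e.leftComodule.IsQuasifinite) :
    e.partFunctor.IsRightAdjoint := by
  rw [isRightAdjoint_iff_hasInitial_structuredArrow]
  intro N
  obtain ⟨M, f, hf⟩ := e.exists_isUniversal h N
  choose b hb using hf.exists_fac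
  have : IsInitial (StructuredArrow.mk (T := e.partFunctor) f) :=
    IsInitial.ofUniqueHom (fun Y => StructuredArrow.homMk (b _ Y.hom) (hb _ Y.hom))
      fun Y m => by
        ext1
        refine hf.generates.hom_ext ?_
        exact (StructuredArrow.w m).trans (hb _ Y.hom).symm
  exact this.hasInitial

theorem isColocalizing_of_isQuasifinite (h : e.leftComodule.IsQuasifinite) :
    IsColocalizing e.localizingSubcategory :=
  e.isColocalizing_of_isRightAdjoint (e.isRightAdjoint_partFunctor h)

end DualIdempotent


namespace RightComodule

variable {K : Type u} [Field K] {C : Type t} [AddCommGroup C] [Module K C] [Coalgebra K C]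

/-! ### Homomorphisms from one-dimensional comodules -/

/-- The subspace of all `m` with `ρ(m) = m ⊗ g`. -/
def eigenspace (M : RightComodule K C) (g : C) : Submodule K M :=
  LinearMap.eqLocus M.coact ((TensorProduct.mk K M C).flip g)

theorem mem_eigenspace {M : RightComodule K C} {g : C} {m : M} :
    m ∈ M.eigenspace g ↔ M.coact m = m ⊗ₜ g := Iff.rfl

theorem mem_eigenspace_of_act {M : RightComodule K C} {g : C} {m : M}
    (h : ∀ f : C →ₗ[K] K, M.act f m = f g • m) : m ∈ M.eigenspace g :=
  TensorProduct.ext_rid_lTensor fun f => (h f).trans (by simp)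

theorem lin_mem_eigenspace {M N : RightComodule K C} (f : M ⟶ N) {g : C} {m : M}
    (hm : m ∈ M.eigenspace g) : f.lin m ∈ N.eigenspace g := by
  rw [mem_eigenspace] at hm ⊢
  rw [lin_coact, hm, LinearMap.rTensor_tmul]

theorem exists_hom_of_eigenspace {S M : RightComodule K C} {g : C} {s : S} (hs0 : s ≠ 0)
    (hs : s ∈ S.eigenspace g) (hspan : ∀ z : S, ∃ a : K, z = a • s) {m : M}
    (hm : m ∈ M.eigenspace g) : ∃ f : S ⟶ M, f.lin s = m := by
  obtain ⟨l, hl⟩ := Module.Projective.exists_dual_ne_zero K hs0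
  refine ⟨⟨((l s)⁻¹ • l).smulRight m, LinearMap.ext fun z => ?_⟩, by simp [hl]⟩
  obtain ⟨a, rfl⟩ := hspan z
  rw [mem_eigenspace] at hs hm
  simp [hs, hm, hl, TensorProduct.smul_tmul']

/-- Evaluation at `s` embeds `Hom(S, M)` into the eigenspace, because a nonzero map from a simple
comodule is injective. -/
theorem finite_hom_of_finite_eigenspace {S M : RightComodule K C} [Simple S] {g : C} {s : S}
    (hs0 : s ≠ 0) (hs : s ∈ S.eigenspace g) [Module.Finite K (M.eigenspace g)] :
    Module.Finite K (S ⟶ M) := by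
  let Φ : (S ⟶ M) →ₗ[K] M.eigenspace g :=
    { toFun := fun f => ⟨f.lin s, lin_mem_eigenspace f hs⟩
      map_add' := fun _ _ => rfl
      map_smul' := fun _ _ => rfl }
  refine Module.Finite.of_injective Φ ((injective_iff_map_eq_zero Φ).2 fun f hf => ?_)
  by_contra hne
  have := mono_of_nonzero_from_simple hne
  have h0 : f.lin s = 0 := congrArg Subtype.val hf
  exact hs0 (injective_of_mono f (h0.trans (map_zero _).symm))

theorem act_of_mem_eigenspace {M : RightComodule K C} {g : C} {m : M} (hm : m ∈ M.eigenspace g)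
    (f : C →ₗ[K] K) : M.act f m = f g • m := by
  rw [mem_eigenspace] at hm
  rw [act_apply, hm, LinearMap.lTensor_tmul, TensorProduct.rid_tmul]

theorem exists_one_dimensional_of_eigenspace {M : RightComodule K C} {g : C} {m : M}
    (hm : m ∈ M.eigenspace g) (hm0 : m ≠ 0) : ∃ (S : RightComodule K C) (s : S), s ≠ 0 ∧
      s ∈ S.eigenspace g ∧ ∀ z : S, ∃ a : K, z = a • s := by
  have hT : M.IsSubcomodule (Submodule.span K {m}) := isSubcomodule_of_act fun f n hn => by
    obtain ⟨a, rfl⟩ := Submodule.mem_span_singleton.1 hn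
    rw [map_smul, act_of_mem_eigenspace hm]
    exact Submodule.smul_mem _ _ (Submodule.smul_mem _ _ (Submodule.mem_span_singleton_self m))
  refine ⟨M.sub _ hT, subMk hT m (Submodule.mem_span_singleton_self m),
    fun h => hm0 (congrArg Subtype.val h), mem_eigenspace_of_act fun f => ?_, fun z => ?_⟩
  · rw [act_subMk]
    exact Subtype.ext (act_of_mem_eigenspace hm f)
  · obtain ⟨a, ha⟩ := Submodule.mem_span_singleton.1 z.2
    exact ⟨a, Subtype.ext ha.symm⟩

/-- A group-like element spans a one-dimensional comodule. -/
theorem exists_one_dimensional {g : C} (hg : IsGroupLikeElem K g) :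
    ∃ (S : RightComodule K C) (s : S), s ≠ 0 ∧ s ∈ S.eigenspace g ∧ ∀ z : S, ∃ a : K, z = a • s :=
  exists_one_dimensional_of_eigenspace (M := regular K C) (m := g) hg.comul_eq_tmul_self
    hg.ne_zero

theorem isQuasifinite_of_finite_eigenspace (M : RightComodule K C) (G : Set C)
    (hG : ∀ g ∈ G, Module.Finite K (M.eigenspace g))
    (h : ∀ S : RightComodule K C, Nontrivial S → ∃ g ∈ G, ∃ s ∈ S.eigenspace g, s ≠ 0) :
    M.IsQuasifinite := fun S hS => by
  have : Nontrivial S := by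
    by_contra hn
    rw [not_nontrivial_iff_subsingleton] at hn
    exact Simple.not_isZero S ((IsZero.iff_id_eq_zero _).2
      (hom_ext (LinearMap.ext fun z => Subsingleton.elim _ _)))
  obtain ⟨g, hg, s, hs, hs0⟩ := h S this
  have := hG g hg
  exact finite_hom_of_finite_eigenspace hs0 hs

/-- The other half of cofreeness: a homomorphism to `C` comes from its composite with the counit.
Every value `f(m)` is therefore a contraction of `ρ(m)`. -/
theorem lin_eq_lid_rTensor {M : RightComodule K C} (f : M ⟶ regular K C) (m : M) :
    f.lin m = TensorProduct.lid K C ((regularCounit K C ∘ₗ f.lin).rTensor C (M.coact m)) := by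
  rw [LinearMap.rTensor_comp_apply, ← lin_coact]
  have h := LinearMap.congr_fun (Coalgebra.rTensor_counit_comp_comul (R := K) (A := C)) (f.lin m)
  exact ((congrArg (TensorProduct.lid K C) h).trans
    ((TensorProduct.lid_tmul _ _).trans (one_smul K _))).symm

end RightComodule

/-! ### From a left adjoint of the quotient functor to finite eigenspaces -/

namespace DualIdempotent

open RightComodule

variable {K : Type u} [Field K] {C : Type t} [AddCommGroup C] [Module K C] [Coalgebra K C]
  (e : DualIdempotent K C)

/-- Take `P` to be the left adjoint applied to `Q N`, and `u` the unit transported through the fully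
faithful functor `F`: maps `eN ⟶ eM` are maps `Q N ⟶ Q M`, hence come from maps `P ⟶ M`. Uniqueness
of the factorization is not needed later. -/
theorem exists_fac_of_isColocalizing (h : IsColocalizing e.localizingSubcategory)
    (N : RightComodule K C) : ∃ (P : RightComodule K C) (u : e.part N ⟶ e.part P),
      ∀ (M : RightComodule K C) (f : e.part N ⟶ e.part M), ∃ g : P ⟶ M, u ≫ e.partMap g = f := by
  let Q := e.localizingSubcategory.isoModSerre.Q
  have hQ : Q.IsRightAdjoint := h
  let adj := Adjunction.ofIsRightAdjoint Q
  let i := e.quotientFunctorFac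
  let F := e.quotientFunctor
  refine ⟨_, i.inv.app N ≫ F.map (adj.unit.app (Q.obj N)) ≫ i.hom.app _,
    fun M (f : e.partFunctor.obj N ⟶ e.partFunctor.obj M) => ?_⟩
  let φ : Q.obj N ⟶ Q.obj M := F.preimage (i.hom.app N ≫ f ≫ i.inv.app M)
  have hφ : F.map φ = i.hom.app N ≫ f ≫ i.inv.app M := F.map_preimage _
  obtain ⟨g, hg⟩ := (adj.homEquiv _ _).surjective φ
  rw [Adjunction.homEquiv_unit] at hg
  refine ⟨g, ?_⟩
  have hn : F.map (Q.map g) ≫ i.hom.app M = i.hom.app _ ≫ e.partFunctor.map g := i.hom.naturality g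
  change (i.inv.app N ≫ F.map (adj.unit.app (Q.obj N)) ≫ i.hom.app _) ≫ e.partFunctor.map g = f
  rw [Category.assoc, Category.assoc, ← hn, ← Category.assoc (F.map _), ← F.map_comp]
  refine (congrArg (fun k => i.inv.app N ≫ F.map k ≫ i.hom.app M) hg).trans ?_
  change i.inv.app N ≫ F.map φ ≫ i.hom.app M = f
  rw [hφ, Category.assoc, Category.assoc, Iso.inv_hom_id_app, Iso.inv_hom_id_app_assoc,
    Category.comp_id]

theorem finite_eigenspace_of_isColocalizing (h : IsColocalizing e.localizingSubcategory) {g : C}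
    (hg : IsGroupLikeElem K g) (he : e.fn g = 1) :
    Module.Finite K (e.leftComodule.eigenspace (e.toCorner g)) := by
  obtain ⟨N, n, hn0, hn, hspan'⟩ := exists_one_dimensional hg
  let s := e.partπ N n
  have hsn : e.partι N s = n := by rw [partι_partπ, act_of_mem_eigenspace hn, he, one_smul]
  have hs0 : s ≠ 0 := fun h => hn0 (by rw [← hsn, h, map_zero])
  have hspan : ∀ z : e.part N, ∃ a : K, z = a • s := fun z => by
    obtain ⟨a, ha⟩ := hspan' (e.partι N z)
    exact ⟨a, e.partι_injective N (by rw [map_smul, hsn, ha])⟩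
  have hs : s ∈ (e.part N).eigenspace (e.toCorner g) := mem_eigenspace_of_act fun f => by
    rw [part_act_partπ, act_of_mem_eigenspace hn, map_smul]
    rfl
  obtain ⟨P, u, hu⟩ := e.exists_fac_of_isColocalizing h N
  -- An eigenvector `w` of `eC` is the image of `s` under some `eN ⟶ eC`, hence the image of the
  -- fixed element `u(s)` under some `P ⟶ C`. All such images lie in the space `U` of contractions
  -- of `ρ(u(s))`.
  obtain ⟨U, _, hU⟩ := TensorProduct.exists_finite_lid_rTensor_mem
    (P.coact (e.partι P (u.lin s)))
  have hW : ∀ w : (e.part (regular K C)).eigenspace (e.toCorner g),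
      e.partι (regular K C) w ∈ U := fun w => by
    obtain ⟨f, hf⟩ := exists_hom_of_eigenspace hs0 hs hspan w.2
    obtain ⟨k, hk⟩ := hu _ f
    rw [← hf, ← hk]
    change e.partι (regular K C) ((e.partMap k).lin (u.lin s)) ∈ U
    rw [partι_partMap, lin_eq_lid_rTensor]
    exact hU _
  let Φ : (e.part (regular K C)).eigenspace (e.toCorner g) →ₗ[K] U :=
    (e.partι (regular K C) ∘ₗ Submodule.subtype _).codRestrict U hW
  have hΦ : Function.Injective Φ := fun a b hab =>
    Subtype.ext (e.partι_injective _ (congrArg (fun z : U => (z : C)) hab))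
  exact Module.Finite.of_injective Φ hΦ

end DualIdempotent


namespace PathCoalgebra

open RightComodule

variable {K : Type u} [Field K] {V : Type v} [Quiver.{w} V]

/-! ### Coordinates and vertex projections on the path coalgebra -/

variable (K) in
/-- The coefficient of a path. -/
def coeff {a b : V} (p : Quiver.Path a b) : PathCoalgebra K V →ₗ[K] K :=
  Finsupp.lapply (⟨a, b, p⟩ : Σ a b : V, Quiver.Path a b)

open Classical in
theorem coeff_of {a b c d : V} (p : Quiver.Path a b) (q : Quiver.Path c d) :
    coeff K p (of K q) = if (⟨a, b, p⟩ : Σ a b : V, Quiver.Path a b) = ⟨c, d, q⟩ then 1 else 0 := by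
  change Finsupp.single (⟨c, d, q⟩ : Σ a b : V, Quiver.Path a b) (1 : K) ⟨a, b, p⟩ = _
  rw [Finsupp.single_apply]
  simp only [eq_comm]

theorem coeff_of_self {a b : V} (p : Quiver.Path a b) : coeff K p (of K p) = 1 := by
  rw [coeff_of, if_pos rfl]

theorem coeff_of_length_ne {a b c d : V} (p : Quiver.Path a b) (q : Quiver.Path c d)
    (h : p.length ≠ q.length) : coeff K p (of K q) = 0 := by
  rw [coeff_of, if_neg]
  intro h'
  cases h'
  exact h rfl

theorem eq_sum_coeff (z : PathCoalgebra K V) :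
    ∃ T : Finset (Σ a b : V, Quiver.Path a b), (∀ p, p ∈ T ↔ coeff K p.2.2 z ≠ 0) ∧
      z = ∑ p ∈ T, coeff K p.2.2 z • of K p.2.2 := by
  refine ⟨Finsupp.support z, fun p => Finsupp.mem_support_iff, ?_⟩
  refine (Finsupp.sum_single z).symm.trans (Finset.sum_congr rfl fun p _ => ?_)
  exact (Finsupp.smul_single_one p _).symm

theorem nodup_splittings {a b : V} (p : Quiver.Path a b) : (splittings p).Nodup := by
  induction p with
  | nil => simp [splittings]
  | cons p α ih =>
    simp only [splittings, List.nodup_cons, List.mem_map]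
    refine ⟨?_, ih.map ?_⟩
    · rintro ⟨s, -, h⟩
      simpa using congrArg (fun r => r.2.2.length) h
    · rintro ⟨c, x, y⟩ ⟨d, x', y'⟩ h
      cases h
      rfl

/-- The coefficient functionals multiply like paths. -/
theorem conv_coeff {a b c : V} (p : Quiver.Path a b) (q : Quiver.Path b c) :
    conv (coeff K q) (coeff K p) = coeff K (p.comp q) := by
  classical
  refine linearMap_ext fun x y r => ?_
  have h1 : conv (coeff K q) (coeff K p) (of K r) =
      ((splittings r).map fun s => coeff K q (of K s.2.2) * coeff K p (of K s.2.1)).sum := by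
    rw [conv_apply, comul_of, map_list_sum, map_list_sum, List.map_map, List.map_map]
    rfl
  rw [h1, coeff_of]
  split_ifs with h
  · cases h
    -- Exactly one decomposition contributes, and `nodup_splittings` ensures that it is counted
    -- once.
    have h2 : ∀ s ∈ splittings (p.comp q), coeff K q (of K s.2.2) * coeff K p (of K s.2.1) =
        if s = ⟨b, p, q⟩ then 1 else 0 := by
      rintro ⟨d, p', q'⟩ -
      split_ifs with hs
      · cases hs
        rw [coeff_of_self, coeff_of_self, one_mul]
      · rw [coeff_of, coeff_of]
        by_cases hq : (⟨b, c, q⟩ : Σ a b : V, Quiver.Path a b) = ⟨d, c, q'⟩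
        · by_cases hp : (⟨a, b, p⟩ : Σ a b : V, Quiver.Path a b) = ⟨a, d, p'⟩
          · cases hq
            cases hp
            exact absurd rfl hs
          · rw [if_neg hp, mul_zero]
        · rw [if_neg hq, zero_mul]
    rw [List.map_congr_left h2, ← List.sum_toFinset _ (nodup_splittings _), Finset.sum_ite_eq',
      if_pos]
    rw [List.mem_toFinset, mem_splittings]
  · refine List.sum_eq_zero fun z hz => ?_
    obtain ⟨⟨d, p', q'⟩, hs, rfl⟩ := List.mem_map.1 hz
    rw [mem_splittings] at hs
    simp only at hs
    subst hs
    simp only [coeff_of]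
    by_cases hq : (⟨b, c, q⟩ : Σ a b : V, Quiver.Path a b) = ⟨d, y, q'⟩
    · by_cases hp : (⟨a, b, p⟩ : Σ a b : V, Quiver.Path a b) = ⟨x, d, p'⟩
      · cases hq
        cases hp
        exact absurd rfl h
      · rw [if_neg hp, mul_zero]
    · rw [if_neg hq, zero_mul]

open Classical in
/-- The projection of `KQ` onto the span of the paths that start in `X`. -/
def sourceProj (K : Type u) [Field K] (X : Set V) : PathCoalgebra K V →ₗ[K] PathCoalgebra K V :=
  lift fun a _ p => if a ∈ X then of K p else 0

open Classical in
/-- The projection of `KQ` onto the span of the paths that end in `X`. -/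
def targetProj (K : Type u) [Field K] (X : Set V) : PathCoalgebra K V →ₗ[K] PathCoalgebra K V :=
  lift fun _ b p => if b ∈ X then of K p else 0

theorem sourceProj_of_mem {X : Set V} {a b : V} (p : Quiver.Path a b) (h : a ∈ X) :
    sourceProj K X (of K p) = of K p := by rw [sourceProj, lift_of, if_pos h]

theorem sourceProj_of_notMem {X : Set V} {a b : V} (p : Quiver.Path a b) (h : a ∉ X) :
    sourceProj K X (of K p) = 0 := by rw [sourceProj, lift_of, if_neg h]

theorem targetProj_of_mem {X : Set V} {a b : V} (p : Quiver.Path a b) (h : b ∈ X) :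
    targetProj K X (of K p) = of K p := by rw [targetProj, lift_of, if_pos h]

theorem targetProj_of_notMem {X : Set V} {a b : V} (p : Quiver.Path a b) (h : b ∉ X) :
    targetProj K X (of K p) = 0 := by rw [targetProj, lift_of, if_neg h]

theorem coeff_sourceProj {X : Set V} {a b : V} (p : Quiver.Path a b) (h : a ∈ X) :
    coeff K p ∘ₗ sourceProj K X = coeff K p := linearMap_ext fun c d q => by
  by_cases hc : c ∈ X
  · rw [LinearMap.comp_apply, sourceProj_of_mem q hc]
  · rw [LinearMap.comp_apply, sourceProj_of_notMem q hc, map_zero, coeff_of, if_neg]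
    intro h'
    cases h'
    exact hc h

theorem coeff_targetProj {X : Set V} {a b : V} (p : Quiver.Path a b) (h : b ∈ X) :
    coeff K p ∘ₗ targetProj K X = coeff K p := linearMap_ext fun c d q => by
  by_cases hc : d ∈ X
  · rw [LinearMap.comp_apply, targetProj_of_mem q hc]
  · rw [LinearMap.comp_apply, targetProj_of_notMem q hc, map_zero, coeff_of, if_neg]
    intro h'
    cases h'
    exact hc h

theorem coeff_sourceProj_eq_zero {X : Set V} {a b : V} (p : Quiver.Path a b) (h : a ∉ X) :
    coeff K p ∘ₗ sourceProj K X = 0 := linearMap_ext fun c d q => by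
  by_cases hc : c ∈ X
  · rw [LinearMap.comp_apply, sourceProj_of_mem q hc, coeff_of, if_neg]
    · rfl
    · intro h'
      cases h'
      exact h hc
  · rw [LinearMap.comp_apply, sourceProj_of_notMem q hc, map_zero]
    rfl

theorem coeff_targetProj_eq_zero {X : Set V} {a b : V} (p : Quiver.Path a b) (h : b ∉ X) :
    coeff K p ∘ₗ targetProj K X = 0 := linearMap_ext fun c d q => by
  by_cases hc : d ∈ X
  · rw [LinearMap.comp_apply, targetProj_of_mem q hc, coeff_of, if_neg]
    · rfl
    · intro h'
      cases h'
      exact h hc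
  · rw [LinearMap.comp_apply, targetProj_of_notMem q hc, map_zero]
    rfl

/-- The second tensor factor of `Δ` holds the initial part, so only the trivial initial part
survives: left multiplication by `e` tests the source of a path, and right multiplication its
target. -/
theorem rid_lTensor_vertexFn (X : Set V) (z : PathCoalgebra K V) :
    TensorProduct.rid K _ ((vertexFn K X).lTensor _ (Coalgebra.comul (R := K) z)) =
      sourceProj K X z := by
  classical
  refine LinearMap.congr_fun (f := (TensorProduct.rid K _).toLinearMap ∘ₗ
    (vertexFn K X).lTensor _ ∘ₗ Coalgebra.comul) (linearMap_ext fun a b p => ?_) z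
  have h := sum_splittings_counit p fun c x y => if a ∈ X then of K y else 0
  rw [sourceProj, lift_of]
  refine Eq.trans ?_ (h.trans ?_)
  · rw [LinearMap.comp_apply, LinearMap.comp_apply, comul_of, map_list_sum, map_list_sum,
      List.map_map, List.map_map]
    refine congrArg List.sum (List.map_congr_left fun s _ => ?_)
    simp only [Function.comp_apply, LinearMap.lTensor_tmul, LinearEquiv.coe_coe,
      TensorProduct.rid_tmul, vertexFn_of]
    by_cases hl : s.2.1.length = 0 <;> by_cases ha : a ∈ X <;> simp [hl, ha]
  · congr

theorem lid_rTensor_vertexFn (X : Set V) (z : PathCoalgebra K V) :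
    TensorProduct.lid K _ ((vertexFn K X).rTensor _ (Coalgebra.comul (R := K) z)) =
      targetProj K X z := by
  classical
  refine LinearMap.congr_fun (f := (TensorProduct.lid K _).toLinearMap ∘ₗ
    (vertexFn K X).rTensor _ ∘ₗ Coalgebra.comul) (linearMap_ext fun a b p => ?_) z
  rw [targetProj, lift_of, LinearMap.comp_apply, LinearMap.comp_apply, comul_of]
  cases p with
  | nil => simp [splittings, vertexFn_of]
  | cons p α => simp [splittings, vertexFn_of, Function.comp_def, map_list_sum]

end PathCoalgebra


namespace PathCoalgebra

open RightComodule

variable {K : Type u} [Field K] {V : Type v} [Quiver.{w} V]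

/-! ### Tails and decompositions of paths -/

theorem vertices_tail_cons {a b c : V} (p : Quiver.Path a b) (α : b ⟶ c) :
    (p.cons α).vertices.tail = p.vertices.tail ++ [c] := by
  rw [Quiver.Path.vertices_cons, List.concat_eq_append,
    List.tail_append_of_ne_nil p.vertices_ne_nil]

theorem mem_vertices_tail_iff {a b z : V} (p : Quiver.Path a b) : z ∈ p.vertices.tail ↔
    ∃ (τ : Quiver.Path a z) (η : Quiver.Path z b), τ.comp η = p ∧ 0 < τ.length := by
  induction p with
  | nil =>
    simp only [Quiver.Path.vertices_nil, List.tail_cons, List.not_mem_nil, false_iff]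
    rintro ⟨τ, η, h, hτ⟩
    have := congrArg Quiver.Path.length h
    simp at this
    lia
  | cons p α ih =>
    rw [vertices_tail_cons, List.mem_append, ih, List.mem_singleton]
    constructor
    · rintro (⟨τ, η, rfl, hτ⟩ | rfl)
      · exact ⟨τ, η.cons α, rfl, hτ⟩
      · exact ⟨p.cons α, .nil, rfl, by simp⟩
    · rintro ⟨τ, η, h, hτ⟩
      cases η with
      | nil => exact Or.inr rfl
      | cons η β =>
        rw [Quiver.Path.comp_cons] at h
        cases h
        exact Or.inl ⟨τ, η, rfl, hτ⟩

/-- Tails in terms of decompositions, the form in which they meet the comultiplication. For `x ∈ X`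
the clause on the intersection with `X` follows from the other one. -/
theorem isTail_iff {X : Set V} {x y : V} (hx : x ∈ X) (p : Quiver.Path x y) : IsTail X p ↔
    0 < p.length ∧ ∀ (z : V) (τ : Quiver.Path x z) (η : Quiver.Path z y),
      τ.comp η = p → 0 < τ.length → z ∉ X := by
  have htail : (∀ z ∈ p.vertices.tail, z ∉ X) ↔ ∀ (z : V) (τ : Quiver.Path x z)
      (η : Quiver.Path z y), τ.comp η = p → 0 < τ.length → z ∉ X :=
    ⟨fun h z τ η hp hτ => h z ((mem_vertices_tail_iff p).2 ⟨τ, η, hp, hτ⟩), fun h z hz => by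
      obtain ⟨τ, η, hp, hτ⟩ := (mem_vertices_tail_iff p).1 hz
      exact h z τ η hp hτ⟩
  rw [IsTail, htail]
  refine ⟨fun h => ⟨h.1, h.2.2⟩, fun h => ⟨h.1, ?_, h.2⟩⟩
  ext z
  constructor
  · rintro ⟨hz, hzX⟩
    have hz' : z ∈ p.vertices.head p.vertices_ne_nil :: p.vertices.tail := by
      rw [List.cons_head_tail]; exact hz
    rw [Quiver.Path.vertices_head_eq, List.mem_cons] at hz'
    exact hz'.resolve_right fun hz => htail.2 h.2 z hz hzX
  · rintro rfl
    exact ⟨p.start_mem_vertices, hx⟩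

/-- An initial part of `q` can equal `p` only if it is all of `q`, which leaves a trivial final part
at the end of `q`. -/
theorem conv_coeff_of_length_le (f : PathCoalgebra K V →ₗ[K] K) {a b c d : V}
    (p : Quiver.Path a b) (q : Quiver.Path c d) (h : q.length ≤ p.length) :
    conv f (coeff K p) (of K q) = f (of K (.nil : Quiver.Path d d)) * coeff K p (of K q) := by
  have h1 : conv f (coeff K p) (of K q) =
      ((splittings q).map fun s => f (of K s.2.2) * coeff K p (of K s.2.1)).sum := by
    rw [conv_apply, comul_of, map_list_sum, map_list_sum, List.map_map, List.map_map]
    rfl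
  rw [h1]
  cases q with
  | nil => simp [splittings]
  | cons q α =>
    simp only [splittings, List.map_cons, List.sum_cons, List.map_map]
    rw [add_eq_left]
    refine List.sum_eq_zero fun z hz => ?_
    obtain ⟨s, hs, rfl⟩ := List.mem_map.1 hz
    rw [mem_splittings] at hs
    have hl := congrArg Quiver.Path.length hs
    rw [Quiver.Path.length_comp] at hl
    rw [Quiver.Path.length_cons] at h
    simp only [Function.comp_apply]
    rw [coeff_of_length_ne p s.2.1 (by lia), mul_zero]

/-! ### Tails as eigenvectors of the projected comultiplication -/

/-- The projection of `KQ` onto the span of the paths that start and end in `X`. -/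
def cornerProj (K : Type u) [Field K] (X : Set V) : PathCoalgebra K V →ₗ[K] PathCoalgebra K V :=
  targetProj K X ∘ₗ sourceProj K X

theorem coeff_cornerProj {X : Set V} {a b : V} (p : Quiver.Path a b) (ha : a ∈ X) (hb : b ∈ X) :
    coeff K p ∘ₗ cornerProj K X = coeff K p := by
  rw [cornerProj, ← LinearMap.comp_assoc, coeff_targetProj p hb, coeff_sourceProj p ha]

theorem mem_of_coeff_cornerProj_ne_zero {X : Set V} {a b : V} (p : Quiver.Path a b)
    (h : coeff K p ∘ₗ cornerProj K X ≠ 0) : a ∈ X ∧ b ∈ X := by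
  rw [cornerProj, ← LinearMap.comp_assoc] at h
  by_cases hb : b ∈ X
  · rw [coeff_targetProj p hb] at h
    exact ⟨by_contra fun ha => h (coeff_sourceProj_eq_zero p ha), hb⟩
  · rw [coeff_targetProj_eq_zero p hb, LinearMap.zero_comp] at h
    exact absurd rfl h

theorem cornerProj_of_mem {X : Set V} {a b : V} (p : Quiver.Path a b) (ha : a ∈ X) (hb : b ∈ X) :
    cornerProj K X (of K p) = of K p := by
  rw [cornerProj, LinearMap.comp_apply, sourceProj_of_mem p ha, targetProj_of_mem p hb]

theorem cornerProj_of_notMem {X : Set V} {a b : V} (p : Quiver.Path a b) (hb : b ∉ X) :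
    cornerProj K X (of K p) = 0 := by
  by_cases ha : a ∈ X
  · rw [cornerProj, LinearMap.comp_apply, sourceProj_of_mem p ha, targetProj_of_notMem p hb]
  · rw [cornerProj, LinearMap.comp_apply, sourceProj_of_notMem p ha, map_zero]

/-- A nontrivial initial part of a tail ends outside `X` and is killed by `cornerProj`; only the
decomposition with trivial initial part remains. -/
theorem map_comul_of_mem_tailSpan {X : Set V} {x : V} (hx : x ∈ X) {z : PathCoalgebra K V}
    (hz : z ∈ tailSpan K X x) : TensorProduct.map (sourceProj K X) (cornerProj K X)
      (Coalgebra.comul (R := K) z) = z ⊗ₜ of K (.nil : Quiver.Path x x) := by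
  classical
  have hle : tailSpan K X x ≤ LinearMap.eqLocus
      (TensorProduct.map (sourceProj K X) (cornerProj K X) ∘ₗ Coalgebra.comul (R := K))
      ((TensorProduct.mk K _ _).flip (of K (.nil : Quiver.Path x x))) := by
    refine Submodule.span_le.2 ?_
    rintro _ ⟨y, p, hp, rfl⟩
    rw [isTail_iff hx] at hp
    have h := sum_splittings_counit p fun c τ η => of K η ⊗ₜ[K] of K τ
    refine Eq.trans ?_ h
    rw [LinearMap.comp_apply, comul_of, map_list_sum, List.map_map]
    refine congrArg List.sum (List.map_congr_left fun s hs => ?_)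
    rw [mem_splittings] at hs
    obtain ⟨c, τ, η⟩ := s
    simp only [Function.comp_apply, TensorProduct.map_tmul]
    split_ifs with hτ
    · cases τ with
      | nil => rw [sourceProj_of_mem η hx, cornerProj_of_mem _ hx hx]
      | cons τ α => simp at hτ
    · rw [cornerProj_of_notMem τ (hp.2 c τ η hs (Nat.pos_of_ne_zero hτ)), TensorProduct.tmul_zero]
  exact hle hz

theorem sourceProj_of_mem_tailSpan {X : Set V} {x : V} (hx : x ∈ X) {z : PathCoalgebra K V}
    (hz : z ∈ tailSpan K X x) : sourceProj K X z = z := by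
  have hle : tailSpan K X x ≤ LinearMap.eqLocus (sourceProj K X) LinearMap.id := by
    refine Submodule.span_le.2 ?_
    rintro _ ⟨y, p, -, rfl⟩
    exact sourceProj_of_mem p hx
  exact hle hz

/-- The converse, proved for each path in the support of `z`: every initial part that ends in `X`
must be the trivial path at `x`. Applied to the trivial initial part, this says that the path starts
at `x`; applied to the others, that it never returns to `X`. -/
theorem mem_sup_tailSpan_of_map_comul {X : Set V} {x : V} (hx : x ∈ X) {z : PathCoalgebra K V}
    (hs : sourceProj K X z = z)
    (hz : TensorProduct.map (sourceProj K X) (cornerProj K X)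
      (Coalgebra.comul (R := K) z) = z ⊗ₜ of K (.nil : Quiver.Path x x)) :
    z ∈ Submodule.span K {of K (.nil : Quiver.Path x x)} ⊔ tailSpan K X x := by
  classical
  obtain ⟨T, hT, hsum⟩ := eq_sum_coeff z
  rw [hsum]
  refine Submodule.sum_mem _ fun q hq => Submodule.smul_mem _ _ ?_
  obtain ⟨a, b, p⟩ := q
  have hp : coeff K p z ≠ 0 := (hT _).1 hq
  have ha : a ∈ X := by
    by_contra ha
    have := LinearMap.congr_fun (coeff_sourceProj_eq_zero (K := K) p ha) z
    rw [LinearMap.comp_apply, hs] at this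
    exact hp this
  have key : ∀ (c : V) (τ : Quiver.Path a c) (η : Quiver.Path c b), τ.comp η = p → c ∈ X →
      (⟨a, c, τ⟩ : Σ a b : V, Quiver.Path a b) = ⟨x, x, .nil⟩ := by
    intro c τ η hpc hc
    -- The coefficients of `η ⊗ τ` are compared on both sides of `hz`: by `conv_coeff` the left one
    -- is that of `p` in `z`, while the right one vanishes unless `τ` is the trivial path at `x`.
    by_contra hne
    have h1 := congrArg (fun y => LinearMap.mul' K K (TensorProduct.map (coeff K η) (coeff K τ) y))
      hz
    simp only [TensorProduct.map_tmul, LinearMap.mul'_apply] at h1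
    rw [coeff_of, if_neg hne, mul_zero, ← LinearMap.comp_apply (TensorProduct.map _ _),
      ← TensorProduct.map_comp, coeff_sourceProj η hc, coeff_cornerProj τ ha hc, ← conv_apply,
      conv_coeff, hpc] at h1
    exact hp h1
  obtain ⟨rfl, -⟩ := Sigma.mk.inj_iff.1 (key a .nil p (Quiver.Path.nil_comp p) ha)
  by_cases hl : 0 < p.length
  · refine Submodule.mem_sup_right (Submodule.subset_span ⟨b, p, (isTail_iff hx p).2 ⟨hl, ?_⟩, rfl⟩)
    intro c τ η hpc hτ hc
    have h2 := congrArg (fun q : Σ a b : V, Quiver.Path a b => q.2.2.length) (key c τ η hpc hc)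
    simp at h2
    lia
  · refine Submodule.mem_sup_left ?_
    cases p with
    | nil => exact Submodule.mem_span_singleton_self _
    | cons p α => simp at hl

/-! ### The comodule `eC` over the localized coalgebra `eCe` -/

variable (C : Subcoalgebra K (PathCoalgebra K V)) (X : Set V)

theorem coe_leftMul (c : C.toSubmodule) :
    ((vertexIdempotent C X).leftMul c : PathCoalgebra K V) = sourceProj K X c := by
  rw [← rid_lTensor_vertexFn]
  have h : ∀ z : C.toSubmodule ⊗[K] C.toSubmodule, C.toSubmodule.subtype
      (TensorProduct.rid K _ ((vertexIdempotent C X).fn.lTensor _ z)) =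
      TensorProduct.rid K _ ((vertexFn K X).lTensor _
        (TensorProduct.map C.toSubmodule.subtype C.toSubmodule.subtype z)) := by
    intro z
    induction z with
    | zero => simp
    | tmul x y => simp [vertexIdempotent]
    | add x y hx hy => simp only [map_add, hx, hy]
  exact (h _).trans (congrArg _ (congrArg _ (LinearMap.congr_fun C.map_subtype_comul c)))

theorem coe_rightMul (c : C.toSubmodule) :
    ((vertexIdempotent C X).rightMul c : PathCoalgebra K V) = targetProj K X c := by
  rw [← lid_rTensor_vertexFn]
  have h : ∀ z : C.toSubmodule ⊗[K] C.toSubmodule, C.toSubmodule.subtype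
      (TensorProduct.lid K _ ((vertexIdempotent C X).fn.rTensor _ z)) =
      TensorProduct.lid K _ ((vertexFn K X).rTensor _
        (TensorProduct.map C.toSubmodule.subtype C.toSubmodule.subtype z)) := by
    intro z
    induction z with
    | zero => simp
    | tmul x y => simp [vertexIdempotent]
    | add x y hx hy => simp only [map_add, hx, hy]
  exact (h _).trans (congrArg _ (congrArg _ (LinearMap.congr_fun C.map_subtype_comul c)))

/-- The inclusion of `eCe` into `KQ`. -/
def cornerι : (vertexIdempotent C X).corner →ₗ[K] PathCoalgebra K V :=
  C.toSubmodule.subtype ∘ₗ (vertexIdempotent C X).corner.subtype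

/-- The inclusion of `eC` into `KQ`. -/
def leftι : (vertexIdempotent C X).left →ₗ[K] PathCoalgebra K V :=
  C.toSubmodule.subtype ∘ₗ (vertexIdempotent C X).left.subtype

theorem cornerι_injective : Function.Injective (cornerι C X) :=
  Subtype.val_injective.comp Subtype.val_injective

theorem leftι_injective : Function.Injective (leftι C X) :=
  Subtype.val_injective.comp Subtype.val_injective

theorem cornerι_toCorner : cornerι C X ∘ₗ (vertexIdempotent C X).toCorner =
    cornerProj K X ∘ₗ C.toSubmodule.subtype := by
  ext c
  change (((vertexIdempotent C X).rightMul ((vertexIdempotent C X).leftMul c) : C.toSubmodule) :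
    PathCoalgebra K V) = _
  rw [coe_rightMul, coe_leftMul]
  rfl

theorem leftι_toLeft : leftι C X ∘ₗ (vertexIdempotent C X).toLeft =
    sourceProj K X ∘ₗ C.toSubmodule.subtype :=
  LinearMap.ext fun c => coe_leftMul C X c

theorem sourceProj_leftι (w : (vertexIdempotent C X).left) :
    sourceProj K X (leftι C X w) = leftι C X w := by
  rw [leftι, LinearMap.comp_apply, ← LinearMap.comp_apply (sourceProj K X), ← leftι_toLeft,
    ← LinearMap.comp_apply]
  obtain ⟨c, rfl⟩ := (vertexIdempotent C X).toLeft_surjective w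
  exact congrArg (leftι C X) (LinearMap.congr_fun (vertexIdempotent C X).toLeft_leftMul c)

theorem map_comul_corner (d : (vertexIdempotent C X).corner) :
    TensorProduct.map (cornerι C X) (cornerι C X) (Coalgebra.comul (R := K) d) =
      TensorProduct.map (cornerProj K X) (cornerProj K X)
        (Coalgebra.comul (R := K) (cornerι C X d)) := by
  rw [DualIdempotent.corner_comul, LinearMap.comp_apply, ← LinearMap.comp_apply
    (TensorProduct.map _ _), ← TensorProduct.map_comp, cornerι_toCorner, TensorProduct.map_comp]
  exact congrArg _ (LinearMap.congr_fun C.map_subtype_comul _)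

theorem map_leftCoact (w : (vertexIdempotent C X).left) :
    TensorProduct.map (leftι C X) (cornerι C X) ((vertexIdempotent C X).leftCoact w) =
      TensorProduct.map (sourceProj K X) (cornerProj K X)
        (Coalgebra.comul (R := K) (leftι C X w)) := by
  rw [DualIdempotent.leftCoact, LinearMap.comp_apply, ← LinearMap.comp_apply
    (TensorProduct.map _ _), ← TensorProduct.map_comp, cornerι_toCorner, leftι_toLeft,
    TensorProduct.map_comp]
  exact congrArg _ (LinearMap.congr_fun C.map_subtype_comul _)

theorem conv_cornerι (f g : PathCoalgebra K V →ₗ[K] K) :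
    conv (f ∘ₗ cornerι C X) (g ∘ₗ cornerι C X) =
      conv (f ∘ₗ cornerProj K X) (g ∘ₗ cornerProj K X) ∘ₗ cornerι C X := by
  ext1 d
  rw [LinearMap.comp_apply, conv_apply, conv_apply, TensorProduct.map_comp, TensorProduct.map_comp,
    LinearMap.comp_apply, map_comul_corner, LinearMap.comp_apply]

variable {C} (hC : IsAdmissible C)

/-- The trivial path at `x`, as an element of an admissible subcoalgebra. -/
def vertex (x : V) : C.toSubmodule := ⟨of K (.nil : Quiver.Path x x), hC.1 x⟩

theorem isGroupLikeElem_vertex (x : V) : IsGroupLikeElem K (vertex hC x) where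
  counit_eq_one := (counit_of (.nil : Quiver.Path x x)).trans (if_pos rfl)
  comul_eq_tmul_self := by
    apply C.map_subtype_injective
    refine (LinearMap.congr_fun C.map_subtype_comul _).trans ?_
    refine (comul_of (.nil : Quiver.Path x x)).trans ?_
    simp [splittings, vertex]

variable {X}

theorem fn_vertex {x : V} (hx : x ∈ X) : (vertexIdempotent C X).fn (vertex hC x) = 1 := by
  classical
  exact (vertexFn_of X (.nil : Quiver.Path x x)).trans (if_pos ⟨rfl, hx⟩)

theorem cornerι_vertex {x : V} (hx : x ∈ X) :
    cornerι C X ((vertexIdempotent C X).toCorner (vertex hC x)) =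
      of K (.nil : Quiver.Path x x) := by
  rw [← LinearMap.comp_apply, cornerι_toCorner]
  exact cornerProj_of_mem _ hx hx

theorem mem_eigenspace_iff {x : V} (hx : x ∈ X) (w : (vertexIdempotent C X).left) :
    w ∈ (vertexIdempotent C X).leftComodule.eigenspace
      ((vertexIdempotent C X).toCorner (vertex hC x)) ↔
    TensorProduct.map (sourceProj K X) (cornerProj K X)
      (Coalgebra.comul (R := K) (leftι C X w)) =
        leftι C X w ⊗ₜ of K (.nil : Quiver.Path x x) := by
  have hinj : Function.Injective (TensorProduct.map (leftι C X) (cornerι C X)) :=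
    TensorProduct.map_injective_of_flat_flat _ _ (leftι_injective C X) (cornerι_injective C X)
  rw [← map_leftCoact, ← cornerι_vertex hC hx, ← TensorProduct.map_tmul, hinj.eq_iff]
  rfl

/-- Inside `KQ` the eigenspace contains the tails in `C` and is contained in their sum with one
line, spanned by the trivial path at `x`. -/
theorem finite_eigenspace_iff {x : V} (hx : x ∈ X) :
    Module.Finite K ((vertexIdempotent C X).leftComodule.eigenspace
      ((vertexIdempotent C X).toCorner (vertex hC x))) ↔
    Module.Finite K ↥(tailSpan K X x ⊓ C.toSubmodule) := by
  let W : Submodule K (vertexIdempotent C X).left :=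
    (vertexIdempotent C X).leftComodule.eigenspace
      ((vertexIdempotent C X).toCorner (vertex hC x))
  have hW : Module.Finite K W ↔ Module.Finite K (W.map (leftι C X)) :=
    ⟨fun _ => inferInstance, fun _ => Module.Finite.equiv
      (Submodule.equivMapOfInjective _ (leftι_injective C X) W).symm⟩
  refine hW.trans ⟨fun _ => ?_, fun _ => ?_⟩
  · refine Submodule.finiteDimensional_of_le (S₂ := W.map (leftι C X)) ?_
    rintro z ⟨hz, hzC⟩
    have hz' : leftι C X ((vertexIdempotent C X).toLeft ⟨z, hzC⟩) = z := by
      rw [← LinearMap.comp_apply, leftι_toLeft]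
      exact sourceProj_of_mem_tailSpan hx hz
    refine ⟨_, (mem_eigenspace_iff hC hx _).2 ?_, hz'⟩
    rw [hz']
    exact map_comul_of_mem_tailSpan hx hz
  · refine Submodule.finiteDimensional_of_le
      (S₂ := Submodule.span K {of K (.nil : Quiver.Path x x)} ⊔ (tailSpan K X x ⊓ C.toSubmodule)) ?_
    -- The modular law, available because the trivial path at `x` lies in `C`.
    rw [← sup_inf_assoc_of_le _ ((Submodule.span_singleton_le_iff_mem _ _).2 (hC.1 x))]
    rintro _ ⟨w, hw, rfl⟩
    exact ⟨mem_sup_tailSpan_of_map_comul hx (sourceProj_leftι C X w)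
      ((mem_eigenspace_iff hC hx w).1 hw), w.1.2⟩

/-! ### Simple comodules over the localized coalgebra -/

/-- A tensor involves only finitely many paths, so a functional acts on it as a finite combination
of coefficient functionals. Allowing every larger `T'` lets the sets for two summands be merged. -/
theorem exists_finset_rid_lTensor {D S : Type*} [AddCommGroup D] [Module K D] [AddCommGroup S]
    [Module K S] (j : D →ₗ[K] PathCoalgebra K V) (z : S ⊗[K] D) :
    ∃ T : Finset (Σ a b : V, Quiver.Path a b), ∀ T', T ⊆ T' → ∀ f : PathCoalgebra K V →ₗ[K] K,
      TensorProduct.rid K S ((f ∘ₗ j).lTensor S z) = ∑ p ∈ T', f (of K p.2.2) •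
        TensorProduct.rid K S ((coeff K p.2.2 ∘ₗ j).lTensor S z) := by
  classical
  induction z with
  | zero => exact ⟨∅, fun T' _ f => by simp⟩
  | tmul x y =>
    obtain ⟨T, hT, hsum⟩ := eq_sum_coeff (j y)
    refine ⟨T, fun T' hT' f => ?_⟩
    simp only [LinearMap.lTensor_tmul, TensorProduct.rid_tmul, LinearMap.comp_apply, smul_smul]
    rw [← Finset.sum_smul]
    congr 1
    conv_lhs => rw [hsum]
    rw [map_sum, ← Finset.sum_subset hT']
    · exact Finset.sum_congr rfl fun p _ => by rw [map_smul, smul_eq_mul, mul_comm]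
    · intro p _ hp
      rw [hT, not_not] at hp
      rw [hp, mul_zero]
  | add x y hx hy =>
    obtain ⟨T, hT⟩ := hx
    obtain ⟨U, hU⟩ := hy
    refine ⟨T ∪ U, fun T' hT' f => ?_⟩
    simp only [map_add, smul_add, Finset.sum_add_distrib]
    rw [hT T' (Finset.union_subset_left hT') f, hU T' (Finset.union_subset_right hT') f]

/-- Every nonzero comodule over `eCe` contains a one-dimensional subcomodule given by a vertex. -/
theorem exists_eigenvector (S : RightComodule K (vertexIdempotent C X).corner) [Nontrivial S] :
    ∃ x ∈ X, ∃ s ∈ S.eigenspace ((vertexIdempotent C X).toCorner (vertex hC x)), s ≠ 0 := by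
  classical
  obtain ⟨s, hs⟩ := exists_ne (0 : S)
  let j := cornerι C X
  obtain ⟨T, hT'⟩ := exists_finset_rid_lTensor j (S.coact s)
  have hT : ∀ f : PathCoalgebra K V →ₗ[K] K, S.act (f ∘ₗ j) s =
      ∑ p ∈ T, f (of K p.2.2) • S.act (coeff K p.2.2 ∘ₗ j) s := hT' T subset_rfl
  have hne : (T.filter fun p => S.act (coeff K p.2.2 ∘ₗ j) s ≠ 0).Nonempty := by
    by_contra h
    rw [Finset.not_nonempty_iff_eq_empty, Finset.filter_eq_empty_iff] at h
    refine hs ?_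
    rw [← S.act_counit s]
    refine (hT Coalgebra.counit).trans (Finset.sum_eq_zero fun p hp => ?_)
    rw [not_not.1 (h hp), smul_zero]
  -- Let `p` be a longest path whose coefficient functional does not kill `s`. Then `f · (p* · s) =
  -- (f ⋆ p*) · s`, where `p*` denotes that functional; paths longer than `p` contribute nothing,
  -- and among the others `conv_coeff_of_length_le` leaves only `p` itself, with factor the value of
  -- `f` at the end `b` of `p`.
  obtain ⟨⟨a, b, p⟩, hp, hmax⟩ := Finset.exists_max_image _ (fun p => p.2.2.length) hne
  obtain ⟨hpT, hp0⟩ := Finset.mem_filter.1 hp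
  obtain ⟨ha, hb⟩ : a ∈ X ∧ b ∈ X := mem_of_coeff_cornerProj_ne_zero (K := K) p fun h => hp0 (by
    have h0 : coeff K p ∘ₗ j = 0 := by
      refine (LinearMap.cancel_right (vertexIdempotent C X).toCorner_surjective).1 ?_
      rw [LinearMap.comp_assoc, cornerι_toCorner, ← LinearMap.comp_assoc, h]
      rfl
    simp only [h0, act_zero])
  refine ⟨b, hb, S.act (coeff K p ∘ₗ j) s, mem_eigenspace_of_act fun f => ?_, hp0⟩
  -- A functional on `eCe` extends to `KQ`, where it can be evaluated on paths.
  obtain ⟨r, hr⟩ := j.exists_leftInverse_of_injective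
    (LinearMap.ker_eq_bot.2 (cornerι_injective C X))
  have hf : f = (f ∘ₗ r) ∘ₗ j := by rw [LinearMap.comp_assoc, hr, LinearMap.comp_id]
  generalize f ∘ₗ r = f' at hf
  subst hf
  rw [← act_conv, conv_cornerι, hT, coeff_cornerProj p ha hb, Finset.sum_eq_single ⟨a, b, p⟩]
  · rw [conv_coeff_of_length_le _ p p le_rfl, coeff_of_self, mul_one, LinearMap.comp_apply,
      cornerProj_of_mem _ hb hb, LinearMap.comp_apply, cornerι_vertex hC hb]
  · rintro ⟨c, d, q⟩ hq hqp
    by_cases hq0 : S.act (coeff K q ∘ₗ j) s = 0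
    · rw [hq0, smul_zero]
    · rw [conv_coeff_of_length_le _ p q (hmax _ (Finset.mem_filter.2 ⟨hq, hq0⟩)), coeff_of,
        if_neg (Ne.symm hqp), mul_zero, zero_smul]
  · exact fun h => absurd hpT h

end PathCoalgebra

end

theorem mainTheorem5 {K : Type u} [Field K] {V : Type v} [Quiver.{w} V]
    (C : Subcoalgebra K (PathCoalgebra K V)) (hC : PathCoalgebra.IsAdmissible C) (X : Set V) :
    List.TFAE [
      IsColocalizing (PathCoalgebra.vertexIdempotent C X).localizingSubcategory,
      (PathCoalgebra.vertexIdempotent C X).leftComodule.IsQuasifinite,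
      ∀ x ∈ X, Module.Finite K ↥(PathCoalgebra.tailSpan K X x ⊓ C.toSubmodule)] := by
  tfae_have 2 → 1 := (PathCoalgebra.vertexIdempotent C X).isColocalizing_of_isQuasifinite
  tfae_have 1 → 3 := fun h x hx => (PathCoalgebra.finite_eigenspace_iff hC hx).1
    ((PathCoalgebra.vertexIdempotent C X).finite_eigenspace_of_isColocalizing h
      (PathCoalgebra.isGroupLikeElem_vertex hC x) (PathCoalgebra.fn_vertex hC hx))
  tfae_have 3 → 2 := fun h => by
    refine RightComodule.isQuasifinite_of_finite_eigenspace _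
      ((fun x => (PathCoalgebra.vertexIdempotent C X).toCorner (PathCoalgebra.vertex hC x)) '' X)
      ?_ fun S _ => ?_
    · rintro _ ⟨x, hx, rfl⟩
      exact (PathCoalgebra.finite_eigenspace_iff hC hx).2 (h x hx)
    · obtain ⟨x, hx, s, hs, hs0⟩ := PathCoalgebra.exists_eigenvector hC S
      exact ⟨_, ⟨x, hx, rfl⟩, s, hs, hs0⟩
  tfae_finish
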